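/- Let $m_1,m_2\ge 0$ be integers. All matrices below are complex, $M^*$ is the conjugate transpose of $M$, and $M>0$ means that $M$ is (Hermitian) positive definite. For $n\ge 0$, a quadruple $\Sigma=\{\alpha,S_0,\vartheta_1,\vartheta_2\}$ of matrices of sizes $n\times n$, $n\times n$, $n\times m_1$, $n\times m_2$ is called admissible if $$S_0>0,\qquad \alpha S_0-S_0\alpha^*=i\Lambda\Lambda^*,\qquad \Lambda:=\begin{bmatrix}\vartheta_1&\vartheta_2\end{bmatrix}.$$ Its first associate function is the rational $m_2\times m_1$ matrix function $$\varphi_{1,\Sigma}(z)=i\vartheta_2^*S_0^{-1}(zI_n-\beta_1)^{-1}\vartheta_1,\qquad \beta_1:=\alpha-i\vartheta_1\vartheta_1^*S_0^{-1}.$$ A rational matrix function is strictly proper if in each of its entries the numerator has smaller degree than the denominator (equivalently, it tends to $0$ at infinity). The McMillan degree of a proper rational matrix function $\varphi$ is the smallest $n$ for which $\varphi$ has a realization $\varphi(z)=D+C(zI_n-A)^{-1}B$ with $A$ of size $n\times n$; a realization with this $n$ is called minimal. A pair $\{A,B\}$ of matrices of sizes $n\times n$ and $n\times k$ is controllable if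 the images of $B,AB,\dots,A^{n-1}B$ together span $\mathbb C^n$. **Theorem.** Let $\varphi$ be a rational $m_2\times m_1$ matrix function. Then $\varphi=\varphi_{1,\Sigma}$ for some admissible quadruple $\Sigma$ (with some $n$) if and only if $\varphi$ is strictly proper. In that case such a $\Sigma$ is obtained by the following procedure. 1. Let $n$ be the McMillan degree of $\varphi$. Then $\varphi$ has a minimal realization of the form $$\varphi(z)=i\theta_2^*(zI_n-\gamma)^{-1}\theta_1,$$ where $\gamma,\theta_1,\theta_2$ are of sizes $n\times n$, $n\times m_1$, $n\times m_2$; take any such realization. 2. The Riccati equation $$\gamma X-X\gamma^*-iX\theta_2\theta_2^*X+i\theta_1\theta_1^*=0$$ has a unique positive definite solution; let $X$ be this solution. 3. Put $$S_0=I_n,\quad \vartheta_1=X^{-1/2}\theta_1,\quad \vartheta_2=X^{1/2}\theta_2,\quad \alpha=X^{-1/2}\gamma X^{1/2}+i\vartheta_1\vartheta_1^*.$$ With these choices the quadruple $\Sigma=\{\alpha,S_0,\vartheta_1,\vartheta_2\}$ is admissible, $\varphi=\varphi_{1,\Sigma}$, and both pairs $\{\alpha,\vartheta_1\}$ and $\{\alpha,\vartheta_2\}$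 are controllable. -/

import Mathlib

open scoped ComplexOrder MatrixOrder Matrix

noncomputable section

/-- A constant complex matrix, regarded as a matrix of rational functions. -/
def constMat {k l : ℕ} (M : Matrix (Fin k) (Fin l) ℂ) : Matrix (Fin k) (Fin l) (RatFunc ℂ) :=
  M.map (fun c => RatFunc.C c)

/-- The resolvent `(z I_n - A)⁻¹` as a matrix of rational functions in `z`. The matrix `z I_n - A`
is invertible over the field of rational functions, its determinant being the characteristic
polynomial of `A`. -/
def resolventMat {n : ℕ} (A : Matrix (Fin n) (Fin n) ℂ) : Matrix (Fin n) (Fin n) (RatFunc ℂ) :=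
  ((RatFunc.X : RatFunc ℂ) • (1 : Matrix (Fin n) (Fin n) (RatFunc ℂ)) - constMat A)⁻¹

/-- A rational matrix function is strictly proper if in every entry the degree of the numerator is
smaller than the degree of the denominator (the zero polynomial has degree `⊥`). -/
def StrictlyProper {p q : ℕ} (φ : Matrix (Fin p) (Fin q) (RatFunc ℂ)) : Prop :=
  ∀ i j, (φ i j).num.degree < (φ i j).denom.degree

/-- `φ(z) = D + C (z I_n - A)⁻¹ B`. -/
def IsStateSpaceRealization {n p q : ℕ} (φ : Matrix (Fin p) (Fin q) (RatFunc ℂ))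
    (A : Matrix (Fin n) (Fin n) ℂ) (B : Matrix (Fin n) (Fin q) ℂ)
    (C : Matrix (Fin p) (Fin n) ℂ) (D : Matrix (Fin p) (Fin q) ℂ) : Prop :=
  φ = constMat D + constMat C * resolventMat A * constMat B

/-- The McMillan degree of a proper rational matrix function: the smallest possible state space
dimension of a realization. (It is used for strictly proper functions only.) -/
def mcMillanDegree {p q : ℕ} (φ : Matrix (Fin p) (Fin q) (RatFunc ℂ)) : ℕ :=
  sInf {n : ℕ | ∃ (A : Matrix (Fin n) (Fin n) ℂ) (B : Matrix (Fin n) (Fin q) ℂ)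
    (C : Matrix (Fin p) (Fin n) ℂ) (D : Matrix (Fin p) (Fin q) ℂ),
    IsStateSpaceRealization φ A B C D}

/-- The rational matrix function `i θ₂* (z I_n - γ)⁻¹ θ₁`. -/
def realizationFun {n m₁ m₂ : ℕ} (γ : Matrix (Fin n) (Fin n) ℂ) (θ₁ : Matrix (Fin n) (Fin m₁) ℂ)
    (θ₂ : Matrix (Fin n) (Fin m₂) ℂ) : Matrix (Fin m₂) (Fin m₁) (RatFunc ℂ) :=
  RatFunc.C Complex.I • (constMat θ₂ᴴ * resolventMat γ * constMat θ₁)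

/-- `φ(z) = i θ₂* (z I_n - γ)⁻¹ θ₁` is a minimal realization of `φ`: its state space dimension `n`
is the McMillan degree of `φ`. -/
def IsMinimalRealization {n m₁ m₂ : ℕ} (φ : Matrix (Fin m₂) (Fin m₁) (RatFunc ℂ))
    (γ : Matrix (Fin n) (Fin n) ℂ) (θ₁ : Matrix (Fin n) (Fin m₁) ℂ)
    (θ₂ : Matrix (Fin n) (Fin m₂) ℂ) : Prop :=
  n = mcMillanDegree φ ∧ φ = realizationFun γ θ₁ θ₂

/-- The pair `{A, B}` is controllable: the images of `B, A B, …, A^(n-1) B` span `ℂⁿ`. -/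
def IsControllablePair {n k : ℕ} (A : Matrix (Fin n) (Fin n) ℂ) (B : Matrix (Fin n) (Fin k) ℂ) :
    Prop :=
  (⨆ ν : Fin n, LinearMap.range (A ^ (ν : ℕ) * B).mulVecLin) = ⊤

/-- A quadruple `{α, S₀, ϑ₁, ϑ₂}` of complex matrices. -/
structure Quadruple (n m₁ m₂ : ℕ) where
  α : Matrix (Fin n) (Fin n) ℂ
  S₀ : Matrix (Fin n) (Fin n) ℂ
  ϑ₁ : Matrix (Fin n) (Fin m₁) ℂ
  ϑ₂ : Matrix (Fin n) (Fin m₂) ℂ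

namespace Quadruple

variable {n m₁ m₂ : ℕ}

/-- `Λ = [ϑ₁ ϑ₂]`. -/
def Λ (Q : Quadruple n m₁ m₂) : Matrix (Fin n) (Fin m₁ ⊕ Fin m₂) ℂ :=
  Matrix.fromCols Q.ϑ₁ Q.ϑ₂

/-- `S₀ > 0` and `α S₀ - S₀ α* = i Λ Λ*`. -/
def IsAdmissible (Q : Quadruple n m₁ m₂) : Prop :=
  Q.S₀.PosDef ∧ Q.α * Q.S₀ - Q.S₀ * Q.αᴴ = Complex.I • (Q.Λ * Q.Λᴴ)

/-- `β₁ = α - i ϑ₁ ϑ₁* S₀⁻¹`. -/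
def β₁ (Q : Quadruple n m₁ m₂) : Matrix (Fin n) (Fin n) ℂ :=
  Q.α - Complex.I • (Q.ϑ₁ * Q.ϑ₁ᴴ * Q.S₀⁻¹)

/-- The first associate function `φ₁(z) = i ϑ₂* S₀⁻¹ (z I_n - β₁)⁻¹ ϑ₁`. -/
def φ₁ (Q : Quadruple n m₁ m₂) : Matrix (Fin m₂) (Fin m₁) (RatFunc ℂ) :=
  RatFunc.C Complex.I • (constMat (Q.ϑ₂ᴴ * Q.S₀⁻¹) * resolventMat Q.β₁ * constMat Q.ϑ₁)

end Quadruple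

/-- `X` is a positive definite solution of `γ X - X γ* - i X θ₂ θ₂* X + i θ₁ θ₁* = 0`. -/
def IsPosDefRiccatiSolution {n m₁ m₂ : ℕ} (γ : Matrix (Fin n) (Fin n) ℂ)
    (θ₁ : Matrix (Fin n) (Fin m₁) ℂ) (θ₂ : Matrix (Fin n) (Fin m₂) ℂ)
    (X : Matrix (Fin n) (Fin n) ℂ) : Prop :=
  X.PosDef ∧
    γ * X - X * γᴴ - Complex.I • (X * θ₂ * θ₂ᴴ * X) + Complex.I • (θ₁ * θ₁ᴴ) = 0

/-- The quadruple `S₀ = I_n`, `ϑ₁ = X^(-1/2) θ₁`, `ϑ₂ = X^(1/2) θ₂`,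
`α = X^(-1/2) γ X^(1/2) + i ϑ₁ ϑ₁*`. -/
def recoveredQuadruple {n m₁ m₂ : ℕ} (γ : Matrix (Fin n) (Fin n) ℂ)
    (θ₁ : Matrix (Fin n) (Fin m₁) ℂ) (θ₂ : Matrix (Fin n) (Fin m₂) ℂ)
    (X : Matrix (Fin n) (Fin n) ℂ) : Quadruple n m₁ m₂ where
  α := (CFC.sqrt X)⁻¹ * γ * CFC.sqrt X +
    Complex.I • (((CFC.sqrt X)⁻¹ * θ₁) * ((CFC.sqrt X)⁻¹ * θ₁)ᴴ)
  S₀ := 1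
  ϑ₁ := (CFC.sqrt X)⁻¹ * θ₁
  ϑ₂ := CFC.sqrt X * θ₂

end

/-! With `A = -iγ`, `B = θ₁`, `C = θ₂*` the Riccati equation becomes `AX + XA* - XC*CX + BB* = 0`,
and minimality of the realization says that no eigenvector of `A*` lies in `ker B*` and none of `A`
in `ker C`.

Existence (`Matrix.exists_posDef_riccati`): the Hamiltonian matrix `[[A, BB*], [C*C, -A*]]` has no
imaginary eigenvalues, so its spectral subspaces for the two half-planes are complementary in
dimension `2n`. A Lyapunov equation makes the Hermitian form `P₂*P₁ + P₁*P₂` positive definite on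
one and negative definite on the other. Hence `P₂` is injective on both, both have dimension `n`,
and `X = P₁P₂⁻¹` on the right half-plane subspace is the solution. Uniqueness
(`Matrix.posDef_riccati_unique`): the difference of two solutions intertwines matrices with disjoint
spectra.

Conjugating by `X^(1/2)` turns the Riccati equation into the admissibility identity and makes `β₁`
similar to `γ`, which gives `φ₁ = φ` and carries the eigenvector conditions over to controllability.
Strict properness is handled by the valuation at infinity in one direction and by a companion
realization in the other. -/

section LinearAlgebra

/-! ### Eigenvectors, intertwining matrices and powers. -/

theorem Matrix.exists_eigenvector_mem {ι : Type*} [Fintype ι] (N : Matrix ι ι ℂ)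
    (W : Submodule ℂ (ι → ℂ)) (hW : W ≠ ⊥) (hN : ∀ v ∈ W, N *ᵥ v ∈ W) :
    ∃ (μ : ℂ) (v : ι → ℂ), v ∈ W ∧ v ≠ 0 ∧ N *ᵥ v = μ • v := by
  have : Nontrivial W := Submodule.nontrivial_iff_ne_bot.2 hW
  obtain ⟨μ, hμ⟩ := Module.End.exists_eigenvalue (N.mulVecLin.restrict (p := W) (q := W) hN)
  obtain ⟨v, hv⟩ := hμ.exists_hasEigenvector
  refine ⟨μ, v, v.2, fun h => hv.2 (Subtype.ext h), ?_⟩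
  exact congrArg Subtype.val hv.apply_eq_smul

/-- A subspace of `ℂ^ι` is the range of an injective matrix. -/
theorem Submodule.exists_matrix_basis {ι : Type*} [Fintype ι] (W : Submodule ℂ (ι → ℂ)) {r : ℕ}
    (hr : Module.finrank ℂ W = r) :
    ∃ P : Matrix ι (Fin r) ℂ, (∀ v, P *ᵥ v = 0 → v = 0) ∧ (∀ v, P *ᵥ v ∈ W) ∧
      ∀ (k : ℕ) (M : Matrix ι (Fin k) ℂ), (∀ v, M *ᵥ v ∈ W) →
        ∃ M' : Matrix (Fin r) (Fin k) ℂ, M = P * M' := by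
  let b := Module.finBasisOfFinrankEq ℂ W hr
  have hP : ∀ v : Fin r → ℂ, (Matrix.of fun i j => (b j : ι → ℂ) i) *ᵥ v
      = ((∑ j, v j • b j : W) : ι → ℂ) := by
    intro v
    ext i
    simp [Matrix.mulVec, dotProduct, mul_comm]
  refine ⟨Matrix.of fun i j => (b j : ι → ℂ) i, ?_, ?_, ?_⟩
  · intro v hv
    rw [hP] at hv
    have := Fintype.linearIndependent_iff.1 b.linearIndependent v (Subtype.ext hv)
    exact funext this
  · intro v
    rw [hP]
    exact Subtype.property _
  · intro k M hM
    refine ⟨Matrix.of fun j l => b.repr ⟨M *ᵥ Pi.single l 1, hM _⟩ j, ?_⟩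
    ext i l
    have h1 := congrFun (hP fun j => b.repr ⟨M *ᵥ Pi.single l 1, hM _⟩ j) i
    rw [b.sum_repr] at h1
    simpa [Matrix.mulVec, dotProduct, Matrix.mul_apply, Pi.single_apply] using h1.symm

variable {ι κ : Type*} [Fintype ι] [DecidableEq ι]

theorem Matrix.exists_eigenvector_of_not_isUnit {N : Matrix ι ι ℂ} {μ : ℂ}
    (h : ¬ IsUnit (algebraMap ℂ (Matrix ι ι ℂ) μ - N)) :
    ∃ v : ι → ℂ, v ≠ 0 ∧ N *ᵥ v = μ • v := by
  rw [Matrix.isUnit_iff_isUnit_det, isUnit_iff_ne_zero, not_not,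
    ← Matrix.exists_mulVec_eq_zero_iff] at h
  obtain ⟨v, hv, h⟩ := h
  refine ⟨v, hv, ?_⟩
  rw [Matrix.sub_mulVec, Algebra.algebraMap_eq_smul_one, Matrix.smul_mulVec, Matrix.one_mulVec,
    sub_eq_zero] at h
  exact h.symm

theorem Matrix.exists_eigenvector_of_isRoot_charpoly {N : Matrix ι ι ℂ} {μ : ℂ}
    (h : N.charpoly.IsRoot μ) : ∃ v : ι → ℂ, v ≠ 0 ∧ N *ᵥ v = μ • v :=
  Matrix.exists_eigenvector_of_not_isUnit (Matrix.mem_spectrum_of_isRoot_charpoly h)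

theorem Matrix.exists_eigenvector_of_conjTranspose {N : Matrix ι ι ℂ} {μ : ℂ} {v : ι → ℂ}
    (hv : v ≠ 0) (h : Nᴴ *ᵥ v = μ • v) : ∃ w : ι → ℂ, w ≠ 0 ∧ N *ᵥ w = star μ • w := by
  apply Matrix.exists_eigenvector_of_not_isUnit
  have h0 : (algebraMap ℂ (Matrix ι ι ℂ) μ - Nᴴ).det = 0 := by
    refine Matrix.exists_mulVec_eq_zero_iff.1 ⟨v, hv, ?_⟩
    rw [Matrix.sub_mulVec, h, Algebra.algebraMap_eq_smul_one, Matrix.smul_mulVec,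
      Matrix.one_mulVec, sub_self]
  have h1 : algebraMap ℂ (Matrix ι ι ℂ) (star μ) - N
      = (algebraMap ℂ (Matrix ι ι ℂ) μ - Nᴴ)ᴴ := by
    simp [Algebra.algebraMap_eq_smul_one]
  rw [Matrix.isUnit_iff_isUnit_det, h1, Matrix.det_conjTranspose, h0]
  simp

theorem Matrix.aeval_mulVec_eigenvector {N : Matrix ι ι ℂ} {μ : ℂ} {v : ι → ℂ}
    (h : N *ᵥ v = μ • v) (p : Polynomial ℂ) :
    (Polynomial.aeval N p) *ᵥ v = p.eval μ • v := by
  induction p using Polynomial.induction_on' with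
  | add p q hp hq => simp [Matrix.add_mulVec, hp, hq, add_smul]
  | monomial k a =>
    have : ∀ k : ℕ, (N ^ k) *ᵥ v = μ ^ k • v := by
      intro k
      induction k with
      | zero => simp
      | succ k ih => rw [pow_succ, ← Matrix.mulVec_mulVec, h, Matrix.mulVec_smul, ih, smul_smul,
          pow_succ, mul_comm]
    rw [Polynomial.aeval_monomial, ← Matrix.mulVec_mulVec, this, Polynomial.eval_monomial,
      Algebra.algebraMap_eq_smul_one, Matrix.smul_mulVec, Matrix.one_mulVec, smul_smul]

theorem Matrix.aeval_mul_of_intertwine [Fintype κ] [DecidableEq κ] {M : Matrix ι ι ℂ}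
    {N : Matrix κ κ ℂ} {D : Matrix ι κ ℂ} (h : M * D = D * N) (p : Polynomial ℂ) :
    Polynomial.aeval M p * D = D * Polynomial.aeval N p := by
  induction p using Polynomial.induction_on' with
  | add p q hp hq => simp [Matrix.add_mul, Matrix.mul_add, hp, hq]
  | monomial k a =>
    have : ∀ k : ℕ, M ^ k * D = D * N ^ k := by
      intro k
      induction k with
      | zero => simp
      | succ k ih => rw [pow_succ, pow_succ, Matrix.mul_assoc, h, ← Matrix.mul_assoc, ih,
          Matrix.mul_assoc]
    simp [Polynomial.aeval_monomial, Algebra.algebraMap_eq_smul_one, this]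

/-- A matrix intertwining two matrices without common eigenvalues vanishes. -/
theorem Matrix.eq_zero_of_intertwine [Fintype κ] [DecidableEq κ] {M : Matrix ι ι ℂ}
    {N : Matrix κ κ ℂ} {D : Matrix ι κ ℂ} (h : M * D = D * N)
    (hMN : ∀ (μ : ℂ) (v : ι → ℂ) (w : κ → ℂ), v ≠ 0 → w ≠ 0 → M *ᵥ v = μ • v →
      N *ᵥ w = μ • w → False) : D = 0 := by
  have hco : IsCoprime M.charpoly N.charpoly := by
    rw [Polynomial.isCoprime_iff_aeval_ne_zero_of_isAlgClosed ℂ ℂ]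
    intro μ
    by_contra! hμ
    obtain ⟨v, hv, hv'⟩ := Matrix.exists_eigenvector_of_isRoot_charpoly (N := M) (μ := μ)
      (by simpa using hμ.1)
    obtain ⟨w, hw, hw'⟩ := Matrix.exists_eigenvector_of_isRoot_charpoly (N := N) (μ := μ)
      (by simpa using hμ.2)
    exact hMN μ v w hv hw hv' hw'
  obtain ⟨a, b, hab⟩ := hco
  have h1 := Matrix.aeval_mul_of_intertwine h M.charpoly
  rw [Matrix.aeval_self_charpoly, Matrix.zero_mul] at h1
  -- Bézout evaluated at `N` shows that `χ_M(N)` is invertible, while `D χ_M(N) = χ_M(M) D = 0`.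
  have h2 := congrArg (Polynomial.aeval N) hab
  rw [map_add, map_mul, map_mul, Matrix.aeval_self_charpoly, mul_zero, add_zero, map_one,
    ← map_mul, mul_comm, map_mul] at h2
  rw [← Matrix.mul_one D, ← h2, ← Matrix.mul_assoc, ← h1, Matrix.zero_mul]

/-- Gelfand's formula: the spectral radius is below some `r < 1`, so eventually `‖K^k‖ ≤ r^k`. -/
theorem Matrix.tendsto_pow_zero (K : Matrix ι ι ℂ)
    (hK : ∀ (μ : ℂ) (v : ι → ℂ), v ≠ 0 → K *ᵥ v = μ • v → ‖μ‖ < 1) :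
    Filter.Tendsto (fun k : ℕ => K ^ k) Filter.atTop (nhds 0) := by
  cases isEmpty_or_nonempty ι
  · exact tendsto_const_nhds.congr fun k => Subsingleton.elim _ _
  let := Matrix.linftyOpNormedRing (n := ι) (α := ℂ)
  let := Matrix.linftyOpNormedAlgebra (n := ι) (α := ℂ) (R := ℂ)
  have : CompleteSpace (Matrix ι ι ℂ) := FiniteDimensional.complete ℂ _
  have hρ : spectralRadius ℂ K < (1 : NNReal) := by
    refine spectrum.spectralRadius_lt_of_forall_lt K fun μ hμ => ?_
    obtain ⟨v, hv, h⟩ := Matrix.exists_eigenvector_of_not_isUnit hμ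
    exact hK μ v hv h
  obtain ⟨r, hr, hr1⟩ := ENNReal.lt_iff_exists_nnreal_btwn.1 hρ
  have hlim := (spectrum.pow_nnnorm_pow_one_div_tendsto_nhds_spectralRadius K).eventually_lt_const hr
  have hr1' : r < 1 := by exact_mod_cast hr1
  refine (tendsto_zero_iff_norm_tendsto_zero (E := Matrix ι ι ℂ)).2 ?_
  refine squeeze_zero' (Filter.Eventually.of_forall fun k => norm_nonneg _) ?_
    (tendsto_pow_atTop_nhds_zero_of_lt_one r.2 hr1')
  filter_upwards [hlim, Filter.eventually_gt_atTop 0] with k hk hk0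
  have h1 := ENNReal.rpow_le_rpow hk.le (Nat.cast_nonneg (α := ℝ) k)
  rw [← ENNReal.rpow_mul, one_div_mul_cancel (by positivity), ENNReal.rpow_one,
    ENNReal.rpow_natCast] at h1
  exact_mod_cast h1

end LinearAlgebra

/-! ### Lyapunov equations. -/

section Lyapunov

variable {ι : Type*} [Fintype ι] [DecidableEq ι]

theorem Complex.norm_one_sub_lt_norm_one_add {μ : ℂ} (hμ : 0 < μ.re) : ‖1 - μ‖ < ‖1 + μ‖ := by
  rw [← sq_lt_sq₀ (norm_nonneg _) (norm_nonneg _), ← Complex.normSq_eq_norm_sq,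
    ← Complex.normSq_eq_norm_sq, Complex.normSq_apply, Complex.normSq_apply]
  simp
  nlinarith

/-- The Cayley transform `K = (1 - N)(1 + N)⁻¹` maps the right half-plane to the unit disc, so `K^k
→ 0`. The Lyapunov equation becomes `G - K*GK ≥ 0`; iterating it and passing to the limit leaves `G
≥ 0`. -/
theorem Matrix.posSemidef_of_lyapunov {N G Q : Matrix ι ι ℂ}
    (hN : ∀ (μ : ℂ) (v : ι → ℂ), v ≠ 0 → N *ᵥ v = μ • v → 0 < μ.re)
    (hG : G.IsHermitian) (hQ : Q.PosSemidef) (h : Nᴴ * G + G * N = Q) : G.PosSemidef := by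
  have hunit : IsUnit (1 + N) := by
    by_contra hc
    obtain ⟨v, hv, hv'⟩ := Matrix.exists_eigenvector_of_not_isUnit (N := N) (μ := -1) (by
      rw [← IsUnit.neg_iff]; simpa [add_comm] using hc)
    have := hN _ _ hv hv'
    norm_num at this
  have hdet := (Matrix.isUnit_iff_isUnit_det _).1 hunit
  set K := (1 - N) * (1 + N)⁻¹ with hK
  have hK1 : K * (1 + N) = 1 - N := by
    rw [hK, Matrix.mul_assoc, Matrix.nonsing_inv_mul _ hdet, Matrix.mul_one]
  have hpow : Filter.Tendsto (fun k : ℕ => K ^ k) Filter.atTop (nhds 0) := by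
    refine Matrix.tendsto_pow_zero K fun μ v hv hKv => ?_
    set w := (1 + N)⁻¹ *ᵥ v with hw
    have hvw : v = (1 + N) *ᵥ w := by
      rw [hw, Matrix.mulVec_mulVec, Matrix.mul_nonsing_inv _ hdet, Matrix.one_mulVec]
    have hw0 : w ≠ 0 := by
      rintro h0
      exact hv (by rw [hvw, h0, Matrix.mulVec_zero])
    have hw1 : (1 - N) *ᵥ w = μ • ((1 + N) *ᵥ w) := by
      rw [← hK1, ← Matrix.mulVec_mulVec, ← hvw, hKv]
    simp only [Matrix.sub_mulVec, Matrix.add_mulVec, Matrix.one_mulVec, smul_add] at hw1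
    have hw2 : (1 + μ) • (N *ᵥ w) = (1 - μ) • w := by
      rw [add_smul, sub_smul, one_smul, one_smul]
      linear_combination (exp := 1) -hw1
    have hμ1 : 1 + μ ≠ 0 := by
      intro h0
      rw [h0, zero_smul] at hw2
      have : (1 - μ) = 0 := (smul_eq_zero.1 hw2.symm).resolve_right hw0
      have h2 : (2 : ℂ) = 0 := by linear_combination h0 + this
      norm_num at h2
    -- The Cayley transform is an involution, so `μ` comes from the eigenvalue `(1 - μ)/(1 + μ)` of
    -- `N`.
    have hNw : N *ᵥ w = ((1 - μ) / (1 + μ)) • w := by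
      rw [div_eq_inv_mul, ← smul_smul, ← hw2, smul_smul, inv_mul_cancel₀ hμ1, one_smul]
    have hre := Complex.norm_one_sub_lt_norm_one_add (hN _ _ hw0 hNw)
    have e1 : 1 - (1 - μ) / (1 + μ) = 2 * μ / (1 + μ) := by field_simp; ring
    have e2 : 1 + (1 - μ) / (1 + μ) = 2 / (1 + μ) := by field_simp; ring
    rw [e1, e2, norm_div, norm_div, norm_mul,
      div_lt_div_iff_of_pos_right (norm_pos_iff.2 hμ1)] at hre
    simpa using hre
  have hstep : (G - Kᴴ * G * K).PosSemidef := by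
    have key : (1 + N)ᴴ * (G - Kᴴ * G * K) * (1 + N) = (2 : ℂ) • Q := by
      have : (1 + N)ᴴ * (G - Kᴴ * G * K) * (1 + N)
          = (1 + N)ᴴ * G * (1 + N) - (K * (1 + N))ᴴ * G * (K * (1 + N)) := by
        rw [Matrix.conjTranspose_mul K]; noncomm_ring
      rw [this, hK1, ← h]
      simp only [Matrix.conjTranspose_add, Matrix.conjTranspose_sub, Matrix.conjTranspose_one,
        two_smul]
      noncomm_ring
    rw [← Matrix.IsUnit.posSemidef_star_left_conjugate_iff hunit, Matrix.star_eq_conjTranspose, key]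
    exact hQ.smul (by norm_num)
  -- Telescoping: each increment is `(K^k)*(G - K*GK)K^k ≥ 0`.
  have hall : ∀ k : ℕ, (G - (K ^ k)ᴴ * G * K ^ k).PosSemidef := by
    intro k
    induction k with
    | zero => simpa using Matrix.PosSemidef.zero
    | succ k ih =>
      have := ih.add (hstep.conjTranspose_mul_mul_same (K ^ k))
      convert this using 1
      rw [pow_succ', Matrix.conjTranspose_mul]
      noncomm_ring
  refine .of_dotProduct_mulVec_nonneg hG fun x => ?_
  have hlim : Filter.Tendsto (fun k : ℕ => star x ⬝ᵥ ((G - (K ^ k)ᴴ * G * K ^ k) *ᵥ x))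
      Filter.atTop (nhds (star x ⬝ᵥ ((G - (0 : Matrix ι ι ℂ)ᴴ * G * 0) *ᵥ x))) := by
    have hc : Continuous fun M : Matrix ι ι ℂ => star x ⬝ᵥ ((G - Mᴴ * G * M) *ᵥ x) := by fun_prop
    exact (hc.tendsto 0).comp hpow
  simp only [Matrix.mul_zero, sub_zero] at hlim
  exact ge_of_tendsto' hlim fun k => (hall k).dotProduct_mulVec_nonneg x

/-- If `Gv = 0` then `v*Qv = 0`, so `Qv = 0` and `GNv = Qv - N*Gv = 0`. Thus `ker G` is
`N`-invariant inside `ker Q`; were it nonzero, it would contain a forbidden eigenvector. -/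
theorem Matrix.posDef_of_lyapunov {N G Q : Matrix ι ι ℂ}
    (hN : ∀ (μ : ℂ) (v : ι → ℂ), v ≠ 0 → N *ᵥ v = μ • v → 0 < μ.re)
    (hG : G.IsHermitian) (hQ : Q.PosSemidef) (h : Nᴴ * G + G * N = Q)
    (hNQ : ∀ (μ : ℂ) (v : ι → ℂ), N *ᵥ v = μ • v → Q *ᵥ v = 0 → v = 0) : G.PosDef := by
  have hG' := Matrix.posSemidef_of_lyapunov hN hG hQ h
  have hQker : ∀ v, G *ᵥ v = 0 → Q *ᵥ v = 0 := by
    intro v hv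
    rw [← hQ.dotProduct_mulVec_zero_iff, ← h, Matrix.add_mulVec, ← Matrix.mulVec_mulVec, hv,
      Matrix.mulVec_zero, zero_add, ← Matrix.mulVec_mulVec, Matrix.dotProduct_mulVec]
    have : star v ᵥ* G = 0 := by
      rw [← hG.eq, ← Matrix.star_mulVec, hv, star_zero]
    rw [this, zero_dotProduct]
  have hbot : LinearMap.ker G.mulVecLin = ⊥ := by
    by_contra hne
    obtain ⟨μ, v, hvW, hv0, hv⟩ := Matrix.exists_eigenvector_mem N _ hne (by
      intro v hv
      rw [LinearMap.mem_ker, Matrix.mulVecLin_apply] at hv ⊢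
      have := hQker v hv
      rw [← h, Matrix.add_mulVec, ← Matrix.mulVec_mulVec, hv, Matrix.mulVec_zero, zero_add] at this
      rwa [Matrix.mulVec_mulVec])
    exact hv0 (hNQ μ v hv (hQker v hvW))
  rw [hG'.posDef_iff_det_ne_zero]
  intro hdet
  obtain ⟨v, hv, hv'⟩ := Matrix.exists_mulVec_eq_zero_iff.2 hdet
  exact hv (by simpa [hbot] using (show v ∈ LinearMap.ker G.mulVecLin from hv'))

end Lyapunov

/-! ### The Riccati equation through its Hamiltonian matrix. -/

section Riccati

variable {n p q : ℕ}

/-- If a matrix has no purely imaginary eigenvalues, its spectral subspaces for the right and the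
left half-plane are complementary. -/
theorem Matrix.exists_halfPlane_splitting {ι : Type*} [Fintype ι] [DecidableEq ι]
    (H : Matrix ι ι ℂ)
    (hH : ∀ (μ : ℂ) (v : ι → ℂ), v ≠ 0 → H *ᵥ v = μ • v → μ.re ≠ 0) :
    ∃ (r s : ℕ) (P : Matrix ι (Fin r) ℂ) (N : Matrix (Fin r) (Fin r) ℂ)
      (P' : Matrix ι (Fin s) ℂ) (N' : Matrix (Fin s) (Fin s) ℂ),
      r + s = Fintype.card ι ∧
      (∀ v, P *ᵥ v = 0 → v = 0) ∧ H * P = P * N ∧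
      (∀ (μ : ℂ) (v : Fin r → ℂ), v ≠ 0 → N *ᵥ v = μ • v → 0 < μ.re) ∧
      (∀ v, P' *ᵥ v = 0 → v = 0) ∧ H * P' = P' * N' ∧
      (∀ (μ : ℂ) (v : Fin s → ℂ), v ≠ 0 → N' *ᵥ v = μ • v → μ.re < 0) := by
  classical
  -- The characteristic polynomial splits as `a * b` by the sign of the real part of the roots; the
  -- two subspaces are `ker a(H)` and `ker b(H)`.
  let a : Polynomial ℂ := ((H.charpoly.roots.filter fun μ => 0 < μ.re).map
    fun μ => Polynomial.X - Polynomial.C μ).prod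
  let b : Polynomial ℂ := ((H.charpoly.roots.filter fun μ => ¬ 0 < μ.re).map
    fun μ => Polynomial.X - Polynomial.C μ).prod
  have hab : a * b = H.charpoly := by
    rw [← Multiset.prod_add, ← Multiset.map_add, Multiset.filter_add_not]
    exact ((IsAlgClosed.splits H.charpoly).eq_prod_roots_of_monic H.charpoly_monic).symm
  have hroot : ∀ μ : ℂ, H.charpoly.IsRoot μ → μ.re ≠ 0 := by
    intro μ hμ
    obtain ⟨v, hv, h⟩ := Matrix.exists_eigenvector_of_isRoot_charpoly hμ
    exact hH μ v hv h
  have ha : ∀ μ : ℂ, a.eval μ = 0 → 0 < μ.re := by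
    intro μ hμ
    rw [Polynomial.eval_multiset_prod, Multiset.prod_eq_zero_iff] at hμ
    simp only [Multiset.mem_map, Multiset.mem_filter, exists_exists_and_eq_and] at hμ
    obtain ⟨ν, ⟨-, hν⟩, h0⟩ := hμ
    simp [sub_eq_zero] at h0
    rwa [h0]
  have hb : ∀ μ : ℂ, b.eval μ = 0 → μ.re < 0 := by
    intro μ hμ
    rw [Polynomial.eval_multiset_prod, Multiset.prod_eq_zero_iff] at hμ
    simp only [Multiset.mem_map, Multiset.mem_filter, exists_exists_and_eq_and] at hμ
    obtain ⟨ν, ⟨hν', hν⟩, h0⟩ := hμ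
    simp [sub_eq_zero] at h0
    rw [h0]
    exact lt_of_le_of_ne (not_lt.1 hν) (hroot ν (Polynomial.isRoot_of_mem_roots hν'))
  have hco : IsCoprime a b := by
    rw [Polynomial.isCoprime_iff_aeval_ne_zero_of_isAlgClosed ℂ ℂ]
    intro μ
    by_contra! hμ
    exact lt_asymm (ha μ (by simpa using hμ.1)) (hb μ (by simpa using hμ.2))
  let f : Module.End ℂ (ι → ℂ) := Matrix.toLinAlgEquiv' H
  have hf : ∀ (c : Polynomial ℂ) (v : ι → ℂ), Polynomial.aeval f c v
      = (Polynomial.aeval H c) *ᵥ v := by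
    intro c v
    have : Polynomial.aeval f c = Matrix.toLinAlgEquiv' (Polynomial.aeval H c) :=
      Polynomial.aeval_algHom_apply (Matrix.toLinAlgEquiv' (R := ℂ) (n := ι)).toAlgHom H c
    rw [this, Matrix.toLinAlgEquiv'_apply]
  have hdisj := Polynomial.disjoint_ker_aeval_of_isCoprime f hco
  have hsup := Polynomial.sup_ker_aeval_eq_ker_aeval_mul_of_coprime f hco
  have htop : LinearMap.ker (Polynomial.aeval f (a * b)) = ⊤ := by
    rw [hab, LinearMap.ker_eq_top]
    refine LinearMap.ext fun v => ?_
    rw [hf, Matrix.aeval_self_charpoly, Matrix.zero_mulVec, LinearMap.zero_apply]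
  rw [htop] at hsup
  have hdim := Submodule.finrank_sup_add_finrank_inf_eq (LinearMap.ker (Polynomial.aeval f a))
    (LinearMap.ker (Polynomial.aeval f b))
  rw [hsup, hdisj.eq_bot, finrank_top, finrank_bot, add_zero, Module.finrank_fintype_fun_eq_card]
    at hdim
  -- `N` is the restriction of `H` to `ker c(H)`, so each of its eigenvalues is a root of `c`.
  have main : ∀ c : Polynomial ℂ, ∃ (P : Matrix ι (Fin (Module.finrank ℂ
      (LinearMap.ker (Polynomial.aeval f c)))) ℂ) (N : Matrix _ _ ℂ),
      (∀ v, P *ᵥ v = 0 → v = 0) ∧ H * P = P * N ∧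
      (∀ (μ : ℂ) v, v ≠ 0 → N *ᵥ v = μ • v → c.eval μ = 0) := by
    intro c
    obtain ⟨P, hP, hPW, hW⟩ := Submodule.exists_matrix_basis
      (LinearMap.ker (Polynomial.aeval f c)) rfl
    obtain ⟨N, hN⟩ := hW _ (H * P) (by
      intro v
      have := hPW v
      rw [LinearMap.mem_ker, hf] at this ⊢
      rw [← Matrix.mulVec_mulVec, Matrix.mulVec_mulVec _ _ H,
        show Polynomial.aeval H c * H = H * Polynomial.aeval H c from
          Matrix.aeval_mul_of_intertwine rfl c,
        ← Matrix.mulVec_mulVec, this, Matrix.mulVec_zero])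
    refine ⟨P, N, hP, hN, fun μ v hv hμ => ?_⟩
    have h1 : H *ᵥ (P *ᵥ v) = μ • (P *ᵥ v) := by
      rw [Matrix.mulVec_mulVec, hN, ← Matrix.mulVec_mulVec, hμ, Matrix.mulVec_smul]
    have h2 := Matrix.aeval_mulVec_eigenvector h1 c
    have h3 := hPW v
    rw [LinearMap.mem_ker, hf, h2] at h3
    exact (smul_eq_zero.1 h3).resolve_right fun h => hv (hP v h)
  obtain ⟨P, N, h1, h2, h3⟩ := main a
  obtain ⟨P', N', h1', h2', h3'⟩ := main b
  exact ⟨_, _, P, N, P', N', hdim.symm, h1, h2, fun μ v hv h => ha μ (h3 μ v hv h), h1', h2',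
    fun μ v hv h => hb μ (h3' μ v hv h)⟩

theorem Matrix.mulVec_eq_zero_of_gram {m k : ℕ} {M : Matrix (Fin m) (Fin k) ℂ} {v : Fin k → ℂ}
    (h : (Mᴴ * M) *ᵥ v = 0) : M *ᵥ v = 0 :=
  (Matrix.conjTranspose_mul_self_mulVec_eq_zero M v).1 h

theorem Matrix.gram_add_gram_ker {m l k : ℕ} {M : Matrix (Fin m) (Fin k) ℂ}
    {L : Matrix (Fin l) (Fin k) ℂ} {v : Fin k → ℂ}
    (h : (Mᴴ * M + Lᴴ * L) *ᵥ v = 0) : M *ᵥ v = 0 ∧ L *ᵥ v = 0 := by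
  have h0 : star v ⬝ᵥ ((Mᴴ * M) *ᵥ v) + star v ⬝ᵥ ((Lᴴ * L) *ᵥ v) = 0 := by
    rw [← dotProduct_add, ← Matrix.add_mulVec, h, dotProduct_zero]
  have hM := Matrix.posSemidef_conjTranspose_mul_self M
  have hL := Matrix.posSemidef_conjTranspose_mul_self L
  have h1 := (add_eq_zero_iff_of_nonneg (hM.dotProduct_mulVec_nonneg v)
    (hL.dotProduct_mulVec_nonneg v)).1 h0
  exact ⟨Matrix.mulVec_eq_zero_of_gram ((hM.dotProduct_mulVec_zero_iff v).1 h1.1),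
    Matrix.mulVec_eq_zero_of_gram ((hL.dotProduct_mulVec_zero_iff v).1 h1.2)⟩

/-- The Lyapunov relation satisfied by the blocks of an invariant subspace of the Hamiltonian
matrix. -/
theorem Matrix.hamiltonian_lyapunov {r : ℕ} {A : Matrix (Fin n) (Fin n) ℂ}
    {B : Matrix (Fin n) (Fin p) ℂ} {C : Matrix (Fin q) (Fin n) ℂ}
    {P₁ P₂ : Matrix (Fin n) (Fin r) ℂ} {N : Matrix (Fin r) (Fin r) ℂ}
    (h₁ : A * P₁ + B * Bᴴ * P₂ = P₁ * N) (h₂ : Cᴴ * C * P₁ - Aᴴ * P₂ = P₂ * N) :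
    Nᴴ * (P₂ᴴ * P₁ + P₁ᴴ * P₂) + (P₂ᴴ * P₁ + P₁ᴴ * P₂) * N
      = (2 : ℂ) • ((C * P₁)ᴴ * (C * P₁) + (Bᴴ * P₂)ᴴ * (Bᴴ * P₂)) := by
  have e₁ : Nᴴ * P₁ᴴ = P₁ᴴ * Aᴴ + P₂ᴴ * (B * Bᴴ) := by
    rw [← Matrix.conjTranspose_mul, ← h₁]
    simp [Matrix.conjTranspose_mul, Matrix.mul_assoc]
  have e₂ : Nᴴ * P₂ᴴ = P₁ᴴ * (Cᴴ * C) - P₂ᴴ * A := by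
    rw [← Matrix.conjTranspose_mul, ← h₂]
    simp [Matrix.conjTranspose_mul, Matrix.mul_assoc]
  have : Nᴴ * (P₂ᴴ * P₁ + P₁ᴴ * P₂) + (P₂ᴴ * P₁ + P₁ᴴ * P₂) * N
      = Nᴴ * P₂ᴴ * P₁ + Nᴴ * P₁ᴴ * P₂ + (P₂ᴴ * (P₁ * N) + P₁ᴴ * (P₂ * N)) := by
    simp only [Matrix.mul_add, Matrix.add_mul, Matrix.mul_assoc]
  rw [this, e₁, e₂, ← h₁, ← h₂]
  simp only [Matrix.conjTranspose_mul, Matrix.conjTranspose_conjTranspose, Matrix.mul_add,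
    Matrix.add_mul, Matrix.mul_sub, Matrix.sub_mul, Matrix.mul_assoc, two_smul]
  abel

/-- On the kernel of the Lyapunov right-hand side, `CP₁v = 0` and `B*P₂v = 0`, so the Hamiltonian
decouples: `A(P₁v) = μP₁v` and `A*(P₂v) = -μP₂v`. The two eigenvector conditions kill both
components. -/
theorem Matrix.hamiltonian_eigenvector_eq_zero {r : ℕ} {A : Matrix (Fin n) (Fin n) ℂ}
    {B : Matrix (Fin n) (Fin p) ℂ} {C : Matrix (Fin q) (Fin n) ℂ}
    (hB : ∀ (μ : ℂ) (y : Fin n → ℂ), Aᴴ *ᵥ y = μ • y → Bᴴ *ᵥ y = 0 → y = 0)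
    (hC : ∀ (μ : ℂ) (x : Fin n → ℂ), A *ᵥ x = μ • x → C *ᵥ x = 0 → x = 0)
    {P₁ P₂ : Matrix (Fin n) (Fin r) ℂ} {N : Matrix (Fin r) (Fin r) ℂ}
    (hP : ∀ v, P₁ *ᵥ v = 0 → P₂ *ᵥ v = 0 → v = 0)
    (h₁ : A * P₁ + B * Bᴴ * P₂ = P₁ * N) (h₂ : Cᴴ * C * P₁ - Aᴴ * P₂ = P₂ * N)
    {μ : ℂ} {v : Fin r → ℂ} (h : N *ᵥ v = μ • v)
    (hQ : ((2 : ℂ) • ((C * P₁)ᴴ * (C * P₁) + (Bᴴ * P₂)ᴴ * (Bᴴ * P₂))) *ᵥ v = 0) : v = 0 := by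
  rw [Matrix.smul_mulVec, smul_eq_zero] at hQ
  obtain ⟨hCv, hBv⟩ := Matrix.gram_add_gram_ker (hQ.resolve_left two_ne_zero)
  rw [← Matrix.mulVec_mulVec] at hCv hBv
  refine hP v (hC μ _ ?_ hCv) (hB (-μ) _ ?_ hBv)
  · have := congrArg (· *ᵥ v) h₁
    simp only [Matrix.add_mulVec, ← Matrix.mulVec_mulVec, hBv, Matrix.mulVec_zero, add_zero, h,
      Matrix.mulVec_smul] at this
    exact this
  · have := congrArg (· *ᵥ v) h₂
    simp only [Matrix.sub_mulVec, ← Matrix.mulVec_mulVec, hCv, Matrix.mulVec_zero, zero_sub, h,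
      Matrix.mulVec_smul] at this
    rw [neg_smul, ← this, neg_neg]

/-- The sign `ε` treats both half-planes at once: since `ε² = 1`, replacing `N` and the form by
their `ε`-multiples leaves the Lyapunov equation unchanged. -/
theorem Matrix.posDef_hamiltonian_form {r : ℕ} {A : Matrix (Fin n) (Fin n) ℂ}
    {B : Matrix (Fin n) (Fin p) ℂ} {C : Matrix (Fin q) (Fin n) ℂ}
    (hB : ∀ (μ : ℂ) (y : Fin n → ℂ), Aᴴ *ᵥ y = μ • y → Bᴴ *ᵥ y = 0 → y = 0)
    (hC : ∀ (μ : ℂ) (x : Fin n → ℂ), A *ᵥ x = μ • x → C *ᵥ x = 0 → x = 0)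
    {P₁ P₂ : Matrix (Fin n) (Fin r) ℂ} {N : Matrix (Fin r) (Fin r) ℂ}
    (hP : ∀ v, P₁ *ᵥ v = 0 → P₂ *ᵥ v = 0 → v = 0)
    (h₁ : A * P₁ + B * Bᴴ * P₂ = P₁ * N) (h₂ : Cᴴ * C * P₁ - Aᴴ * P₂ = P₂ * N) (ε : ℝ)
    (hε : ε = 1 ∨ ε = -1)
    (hN : ∀ (μ : ℂ) (v : Fin r → ℂ), v ≠ 0 → N *ᵥ v = μ • v → 0 < ε * μ.re) :
    ((ε : ℂ) • (P₂ᴴ * P₁ + P₁ᴴ * P₂)).PosDef := by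
  have hε2 : (ε : ℂ) * ε = 1 := by rcases hε with rfl | rfl <;> norm_num
  have hstar : star (ε : ℂ) = ε := Complex.conj_ofReal ε
  have hev : ∀ {μ : ℂ} {v : Fin r → ℂ}, ((ε : ℂ) • N) *ᵥ v = μ • v →
      N *ᵥ v = ((ε : ℂ) * μ) • v := by
    intro μ v h
    rw [← smul_smul, ← h, Matrix.smul_mulVec, smul_smul, hε2, one_smul]
  refine Matrix.posDef_of_lyapunov (N := (ε : ℂ) • N)
    (Q := (2 : ℂ) • ((C * P₁)ᴴ * (C * P₁) + (Bᴴ * P₂)ᴴ * (Bᴴ * P₂))) ?_ ?_ ?_ ?_ ?_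
  · intro μ v hv h
    have := hN _ v hv (hev h)
    rw [Complex.re_ofReal_mul, ← mul_assoc] at this
    rcases hε with rfl | rfl <;> simpa using this
  · rw [Matrix.IsHermitian, Matrix.conjTranspose_smul, hstar]
    simp [Matrix.conjTranspose_mul, add_comm]
  · exact ((Matrix.posSemidef_conjTranspose_mul_self _).add
      (Matrix.posSemidef_conjTranspose_mul_self _)).smul (by norm_num)
  · rw [← Matrix.hamiltonian_lyapunov h₁ h₂, Matrix.conjTranspose_smul, hstar, Matrix.smul_mul,
      Matrix.mul_smul, smul_smul, hε2, Matrix.smul_mul, Matrix.mul_smul, smul_smul, hε2, one_smul,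
      one_smul]
  · intro μ v h hQ
    exact Matrix.hamiltonian_eigenvector_eq_zero hB hC hP h₁ h₂ (hev h) hQ

theorem Matrix.eq_zero_of_posDef_form {r : ℕ} {ε : ℂ} {P₁ P₂ : Matrix (Fin n) (Fin r) ℂ}
    (h : (ε • (P₂ᴴ * P₁ + P₁ᴴ * P₂)).PosDef) {v : Fin r → ℂ} (hv : P₂ *ᵥ v = 0) : v = 0 := by
  by_contra hne
  have h1 := h.dotProduct_mulVec_pos hne
  have h2 : star v ⬝ᵥ ((ε • (P₂ᴴ * P₁ + P₁ᴴ * P₂)) *ᵥ v) = 0 := by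
    rw [Matrix.smul_mulVec, Matrix.add_mulVec, ← Matrix.mulVec_mulVec, ← Matrix.mulVec_mulVec, hv,
      Matrix.mulVec_zero, add_zero, dotProduct_smul, Matrix.dotProduct_mulVec, ← Matrix.star_mulVec,
      hv, star_zero, zero_dotProduct, smul_zero]
  exact h1.ne' h2

theorem Matrix.card_le_of_mulVec_injective {m r : ℕ} {P : Matrix (Fin m) (Fin r) ℂ}
    (h : ∀ v, P *ᵥ v = 0 → v = 0) : r ≤ m := by
  have := LinearMap.finrank_le_finrank_of_injective (f := P.mulVecLin)
    ((injective_iff_map_eq_zero _).2 h)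
  simpa using this

/-- An eigenvector is a one-column invariant subspace with `N = μ`. For imaginary `μ` the left side
of the Lyapunov relation carries the factor `μ̄ + μ = 0`, so the right side vanishes too. -/
theorem Matrix.hamiltonian_eigenvalue_re_ne_zero {A : Matrix (Fin n) (Fin n) ℂ}
    {B : Matrix (Fin n) (Fin p) ℂ} {C : Matrix (Fin q) (Fin n) ℂ}
    (hB : ∀ (μ : ℂ) (y : Fin n → ℂ), Aᴴ *ᵥ y = μ • y → Bᴴ *ᵥ y = 0 → y = 0)
    (hC : ∀ (μ : ℂ) (x : Fin n → ℂ), A *ᵥ x = μ • x → C *ᵥ x = 0 → x = 0)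
    {μ : ℂ} {v : Fin n ⊕ Fin n → ℂ} (hv : v ≠ 0)
    (h : Matrix.fromBlocks A (B * Bᴴ) (Cᴴ * C) (-Aᴴ) *ᵥ v = μ • v) : μ.re ≠ 0 := by
  intro hre
  rw [Matrix.fromBlocks_mulVec] at h
  have hx : A *ᵥ (v ∘ Sum.inl) + (B * Bᴴ) *ᵥ (v ∘ Sum.inr) = μ • (v ∘ Sum.inl) :=
    funext fun i => congrFun h (Sum.inl i)
  have hy : (Cᴴ * C) *ᵥ (v ∘ Sum.inl) + (-Aᴴ) *ᵥ (v ∘ Sum.inr) = μ • (v ∘ Sum.inr) :=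
    funext fun i => congrFun h (Sum.inr i)
  have hcol : ∀ (u : Fin n → ℂ) (c : Fin 1 → ℂ), Matrix.replicateCol (Fin 1) u *ᵥ c = c 0 • u := by
    intro u c
    ext i
    simp [Matrix.mulVec, dotProduct, mul_comm]
  have hmul : ∀ (M : Matrix (Fin n) (Fin n) ℂ) (u : Fin n → ℂ),
      M * Matrix.replicateCol (Fin 1) u = Matrix.replicateCol (Fin 1) (M *ᵥ u) :=
    fun M u => (Matrix.replicateCol_mulVec M u).symm
  have h₁ : A * Matrix.replicateCol (Fin 1) (v ∘ Sum.inl) +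
      B * Bᴴ * Matrix.replicateCol (Fin 1) (v ∘ Sum.inr) =
      Matrix.replicateCol (Fin 1) (v ∘ Sum.inl) * (μ • (1 : Matrix (Fin 1) (Fin 1) ℂ)) := by
    rw [hmul, hmul, ← Matrix.replicateCol_add, hx, Matrix.mul_smul, Matrix.mul_one,
      Matrix.replicateCol_smul]
  have h₂ : Cᴴ * C * Matrix.replicateCol (Fin 1) (v ∘ Sum.inl) -
      Aᴴ * Matrix.replicateCol (Fin 1) (v ∘ Sum.inr) =
      Matrix.replicateCol (Fin 1) (v ∘ Sum.inr) * (μ • (1 : Matrix (Fin 1) (Fin 1) ℂ)) := by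
    rw [sub_eq_add_neg, ← Matrix.neg_mul, hmul, hmul, ← Matrix.replicateCol_add, hy,
      Matrix.mul_smul, Matrix.mul_one, Matrix.replicateCol_smul]
  have hP : ∀ c : Fin 1 → ℂ, Matrix.replicateCol (Fin 1) (v ∘ Sum.inl) *ᵥ c = 0 →
      Matrix.replicateCol (Fin 1) (v ∘ Sum.inr) *ᵥ c = 0 → c = 0 := by
    intro c h1 h2
    rw [hcol, smul_eq_zero] at h1 h2
    by_contra hc
    have hc0 : c 0 ≠ 0 := fun h0 => hc (funext fun i => by rw [Subsingleton.elim i 0]; exact h0)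
    refine hv (funext fun i => ?_)
    rcases i with i | i
    · exact congrFun (h1.resolve_left hc0) i
    · exact congrFun (h2.resolve_left hc0) i
  have hlyap := Matrix.hamiltonian_lyapunov h₁ h₂
  rw [Matrix.conjTranspose_smul, Matrix.conjTranspose_one, Matrix.smul_mul, Matrix.one_mul,
    Matrix.mul_smul, Matrix.mul_one, ← add_smul] at hlyap
  have hμ : star μ + μ = 0 := by
    apply Complex.ext <;> simp [hre]
  rw [hμ, zero_smul] at hlyap
  have := Matrix.hamiltonian_eigenvector_eq_zero hB hC hP h₁ h₂ (μ := μ) (v := 1)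
    (by rw [Matrix.smul_mulVec, Matrix.one_mulVec]) (by rw [← hlyap, Matrix.zero_mulVec])
  exact one_ne_zero (congrFun this 0)

/-- The algebraic Riccati equation of a controllable and observable system has a positive definite
solution. -/
theorem Matrix.exists_posDef_riccati {A : Matrix (Fin n) (Fin n) ℂ}
    {B : Matrix (Fin n) (Fin p) ℂ} {C : Matrix (Fin q) (Fin n) ℂ}
    (hB : ∀ (μ : ℂ) (y : Fin n → ℂ), Aᴴ *ᵥ y = μ • y → Bᴴ *ᵥ y = 0 → y = 0)
    (hC : ∀ (μ : ℂ) (x : Fin n → ℂ), A *ᵥ x = μ • x → C *ᵥ x = 0 → x = 0) :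
    ∃ X : Matrix (Fin n) (Fin n) ℂ, X.PosDef ∧
      A * X + X * Aᴴ - X * (Cᴴ * C) * X + B * Bᴴ = 0 := by
  obtain ⟨r, s, P, N, P', N', hrs, hP, hPN, hN, hP', hPN', hN'⟩ :=
    Matrix.exists_halfPlane_splitting (Matrix.fromBlocks A (B * Bᴴ) (Cᴴ * C) (-Aᴴ))
      fun μ v hv h => Matrix.hamiltonian_eigenvalue_re_ne_zero hB hC hv h
  have blocks : ∀ {k : ℕ} {T : Matrix (Fin n ⊕ Fin n) (Fin k) ℂ} {L : Matrix (Fin k) (Fin k) ℂ},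
      (∀ v, T *ᵥ v = 0 → v = 0) →
      Matrix.fromBlocks A (B * Bᴴ) (Cᴴ * C) (-Aᴴ) * T = T * L →
      (∀ v, T.toRows₁ *ᵥ v = 0 → T.toRows₂ *ᵥ v = 0 → v = 0) ∧
      A * T.toRows₁ + B * Bᴴ * T.toRows₂ = T.toRows₁ * L ∧
      Cᴴ * C * T.toRows₁ - Aᴴ * T.toRows₂ = T.toRows₂ * L := by
    intro k T L hT hTL
    refine ⟨fun v h1 h2 => hT v ?_, ?_⟩
    · rw [← Matrix.fromRows_toRows T, Matrix.fromRows_mulVec, h1, h2]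
      ext i
      rcases i with i | i <;> rfl
    · rw [← Matrix.fromRows_toRows T, Matrix.fromBlocks_mul_fromRows, Matrix.fromRows_mul,
        Matrix.fromRows_inj.eq_iff] at hTL
      simpa [sub_eq_add_neg] using hTL
  obtain ⟨hQ, h₁, h₂⟩ := blocks hP hPN
  obtain ⟨hQ', h₁', h₂'⟩ := blocks hP' hPN'
  have hpos := Matrix.posDef_hamiltonian_form hB hC hQ h₁ h₂ 1 (Or.inl rfl)
    (by simpa using hN)
  have hneg := Matrix.posDef_hamiltonian_form hB hC hQ' h₁' h₂' (-1) (Or.inr rfl)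
    (by simpa using hN')
  have hr := Matrix.card_le_of_mulVec_injective fun v => Matrix.eq_zero_of_posDef_form hpos (v := v)
  have hs := Matrix.card_le_of_mulVec_injective fun v => Matrix.eq_zero_of_posDef_form hneg (v := v)
  -- Both dimensions are at most `n` and they add up to `2n`.
  obtain rfl : r = n := by
    simp only [Fintype.card_sum, Fintype.card_fin] at hrs
    lia
  set P₁ := P.toRows₁
  set P₂ := P.toRows₂
  have hdet : IsUnit P₂.det := by
    rw [isUnit_iff_ne_zero]
    intro h0
    obtain ⟨v, hv, hv'⟩ := Matrix.exists_mulVec_eq_zero_iff.2 h0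
    exact hv (Matrix.eq_zero_of_posDef_form hpos hv')
  have hinv : P₂ * P₂⁻¹ = 1 := Matrix.mul_nonsing_inv _ hdet
  have hinv' : P₂⁻¹ * P₂ = 1 := Matrix.nonsing_inv_mul _ hdet
  set X := P₁ * P₂⁻¹ with hX
  -- `L` is similar to `N`, so its spectrum stays in the right half-plane; the second block row
  -- identifies it as `C*CX - A*`.
  set L := P₂ * N * P₂⁻¹ with hL
  have hXL : A * X + B * Bᴴ = X * L := by
    have := congrArg (· * P₂⁻¹) h₁
    simp only [Matrix.add_mul, Matrix.mul_assoc, hinv, Matrix.mul_one] at this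
    rw [hX, hL, this, Matrix.mul_assoc P₂, Matrix.mul_assoc P₁, ← Matrix.mul_assoc P₂⁻¹, hinv',
      Matrix.one_mul]
  have hLX : Cᴴ * C * X - Aᴴ = L := by
    have := congrArg (· * P₂⁻¹) h₂
    simp only [Matrix.sub_mul, Matrix.mul_assoc, hinv, Matrix.mul_one] at this
    rw [hX, hL, Matrix.mul_assoc, Matrix.mul_assoc, this]
  have hric : A * X + X * Aᴴ - X * (Cᴴ * C) * X + B * Bᴴ = 0 := by
    have : A * X + X * Aᴴ - X * (Cᴴ * C) * X + B * Bᴴ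
        = (A * X + B * Bᴴ) - X * (Cᴴ * C * X - Aᴴ) := by noncomm_ring
    rw [this, hXL, hLX, sub_self]
  have hLeig : ∀ (μ : ℂ) (v : Fin r → ℂ), v ≠ 0 → L *ᵥ v = μ • v → 0 < μ.re := by
    intro μ v hv h
    refine hN μ (P₂⁻¹ *ᵥ v) (fun h0 => hv ?_) ?_
    · rw [← Matrix.one_mulVec v, ← hinv, ← Matrix.mulVec_mulVec, h0, Matrix.mulVec_zero]
    · rw [← Matrix.mulVec_smul, ← h, Matrix.mulVec_mulVec, Matrix.mulVec_mulVec, hL,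
        Matrix.mul_assoc, ← Matrix.mul_assoc P₂⁻¹, hinv', Matrix.one_mul]
  have hLstar : ∀ (μ : ℂ) (v : Fin r → ℂ), v ≠ 0 → Lᴴ *ᵥ v = μ • v → 0 < μ.re := by
    intro μ v hv h
    obtain ⟨w, hw, hw'⟩ := Matrix.exists_eigenvector_of_conjTranspose hv h
    simpa using hLeig _ w hw hw'
  have hXh : X.IsHermitian := by
    have hLh : Xᴴ * (Cᴴ * C) - A = Lᴴ := by
      rw [← hLX]; simp [Matrix.conjTranspose_mul, Matrix.mul_assoc]
    have hric' : A * Xᴴ + Xᴴ * Aᴴ - Xᴴ * (Cᴴ * C) * Xᴴ + B * Bᴴ = 0 := by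
      rw [← Matrix.conjTranspose_zero, ← hric]
      simp only [Matrix.conjTranspose_add, Matrix.conjTranspose_sub, Matrix.conjTranspose_mul,
        Matrix.conjTranspose_conjTranspose, Matrix.mul_assoc, add_comm (A * Xᴴ)]
    -- `X*` solves the same equation. Subtracting gives an intertwining of `L*`, with spectrum on
    -- the right, and `-L`, with spectrum on the left.
    have hD : Lᴴ * (X - Xᴴ) = (X - Xᴴ) * (-L) := by
      have e : (Xᴴ * (Cᴴ * C) - A) * (X - Xᴴ) - (X - Xᴴ) * -(Cᴴ * C * X - Aᴴ) =
          (A * Xᴴ + Xᴴ * Aᴴ - Xᴴ * (Cᴴ * C) * Xᴴ + B * Bᴴ) -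
          (A * X + X * Aᴴ - X * (Cᴴ * C) * X + B * Bᴴ) := by
        noncomm_ring
      rw [hric, hric', sub_self, sub_eq_zero] at e
      rw [← hLh, ← hLX, e]
    have := Matrix.eq_zero_of_intertwine hD (by
      intro μ v w hv hw h1 h2
      have h3 := hLstar μ v hv h1
      have h4 := hLeig (-μ) w hw (by rw [neg_smul, ← h2, Matrix.neg_mulVec, neg_neg])
      rw [Complex.neg_re] at h4
      linarith)
    exact (sub_eq_zero.1 this).symm
  refine ⟨X, ?_, hric⟩
  have hP₁ : P₁ = X * P₂ := by rw [hX, Matrix.mul_assoc, hinv', Matrix.mul_one]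
  have e : (1 / 2 : ℂ) • (((1 : ℝ) : ℂ) • (P₂ᴴ * P₁ + P₁ᴴ * P₂)) = P₂ᴴ * X * P₂ := by
    rw [hP₁, Matrix.conjTranspose_mul, hXh.eq, ← Matrix.mul_assoc, ← two_smul ℂ, smul_smul,
      smul_smul]
    norm_num
  have h2 := hpos.smul (show (0 : ℂ) < 1 / 2 by norm_num)
  rw [e, ← Matrix.star_eq_conjTranspose] at h2
  exact (Matrix.IsUnit.posDef_star_left_conjugate_iff
    ((Matrix.isUnit_iff_isUnit_det _).2 hdet)).1 h2

/-- The closed loop matrix of a positive definite solution of the Riccati equation is stable. -/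
theorem Matrix.riccati_closedLoop_stable {A X : Matrix (Fin n) (Fin n) ℂ}
    {B : Matrix (Fin n) (Fin p) ℂ} {C : Matrix (Fin q) (Fin n) ℂ}
    (hB : ∀ (μ : ℂ) (y : Fin n → ℂ), Aᴴ *ᵥ y = μ • y → Bᴴ *ᵥ y = 0 → y = 0)
    (hX : X.PosDef) (h : A * X + X * Aᴴ - X * (Cᴴ * C) * X + B * Bᴴ = 0)
    {μ : ℂ} {w : Fin n → ℂ} (hw : w ≠ 0) (hμ : (Aᴴ - Cᴴ * C * X) *ᵥ w = μ • w) : μ.re < 0 := by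
  have hXh := hX.isHermitian.eq
  have e : (Aᴴ - Cᴴ * C * X)ᴴ * X + X * (Aᴴ - Cᴴ * C * X)
      = -((C * X)ᴴ * (C * X) + Bᴴᴴ * Bᴴ) := by
    have : (Aᴴ - Cᴴ * C * X)ᴴ * X + X * (Aᴴ - Cᴴ * C * X) + ((C * X)ᴴ * (C * X) + Bᴴᴴ * Bᴴ)
        = A * X + X * Aᴴ - X * (Cᴴ * C) * X + B * Bᴴ := by
      simp only [Matrix.conjTranspose_sub, Matrix.conjTranspose_mul,
        Matrix.conjTranspose_conjTranspose, hXh, Matrix.sub_mul, Matrix.mul_sub, Matrix.mul_assoc]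
      abel
    rw [h] at this
    exact eq_neg_of_add_eq_zero_left this
  have hL : star w ⬝ᵥ (((Aᴴ - Cᴴ * C * X)ᴴ * X + X * (Aᴴ - Cᴴ * C * X)) *ᵥ w)
      = (2 * μ.re : ℝ) * (star w ⬝ᵥ (X *ᵥ w)) := by
    rw [Matrix.add_mulVec, dotProduct_add, ← Matrix.mulVec_mulVec, Matrix.dotProduct_mulVec,
      ← Matrix.star_mulVec, hμ, ← Matrix.mulVec_mulVec, hμ, Matrix.mulVec_smul, dotProduct_smul,
      star_smul, smul_dotProduct, smul_eq_mul, smul_eq_mul, ← add_mul]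
    congr 1
    apply Complex.ext <;> simp
    ring
  have hpos := hX.dotProduct_mulVec_pos hw
  have hQ := ((Matrix.posSemidef_conjTranspose_mul_self (C * X)).add
    (Matrix.posSemidef_conjTranspose_mul_self Bᴴ))
  have hQw := hQ.dotProduct_mulVec_nonneg w
  rw [e, Matrix.neg_mulVec, dotProduct_neg] at hL
  by_contra! hre
  -- If `Re μ ≥ 0`, the identity `-w*Qw = 2 Re μ · w*Xw` forces `w*Qw = 0`; then `CXw = 0` and `B*w
  -- = 0`, so `w` is an eigenvector of `A*` in `ker B*`.
  have hq := le_antisymm (by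
    rw [← neg_nonneg, hL]
    exact mul_nonneg (by exact_mod_cast mul_nonneg zero_le_two hre) hpos.le) hQw
  obtain ⟨h1, h2⟩ := Matrix.gram_add_gram_ker ((hQ.dotProduct_mulVec_zero_iff w).1 hq)
  refine hw (hB μ w ?_ h2)
  rw [← hμ, Matrix.sub_mulVec, Matrix.mul_assoc, ← Matrix.mulVec_mulVec, h1, Matrix.mulVec_zero,
    sub_zero]

/-- `X - Y` intertwines the adjoint of the stable closed loop matrix of `X` with the negative of
that of `Y`, so the spectra lie in opposite half-planes. -/
theorem Matrix.posDef_riccati_unique {A X Y : Matrix (Fin n) (Fin n) ℂ}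
    {B : Matrix (Fin n) (Fin p) ℂ} {C : Matrix (Fin q) (Fin n) ℂ}
    (hB : ∀ (μ : ℂ) (y : Fin n → ℂ), Aᴴ *ᵥ y = μ • y → Bᴴ *ᵥ y = 0 → y = 0)
    (hX : X.PosDef) (h : A * X + X * Aᴴ - X * (Cᴴ * C) * X + B * Bᴴ = 0)
    (hY : Y.PosDef) (h' : A * Y + Y * Aᴴ - Y * (Cᴴ * C) * Y + B * Bᴴ = 0) : X = Y := by
  have hXh := hX.isHermitian.eq
  have hD : (Aᴴ - Cᴴ * C * X)ᴴ * (X - Y) = (X - Y) * (-(Aᴴ - Cᴴ * C * Y)) := by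
    have e : (A - X * (Cᴴ * C)) * (X - Y) - (X - Y) * (-(Aᴴ - Cᴴ * C * Y))
        = (A * X + X * Aᴴ - X * (Cᴴ * C) * X + B * Bᴴ)
          - (A * Y + Y * Aᴴ - Y * (Cᴴ * C) * Y + B * Bᴴ) := by noncomm_ring
    rw [h, h', sub_self, sub_eq_zero] at e
    rw [← e]
    simp [Matrix.conjTranspose_mul, hXh, Matrix.mul_assoc]
  refine sub_eq_zero.1 (Matrix.eq_zero_of_intertwine hD ?_)
  intro μ v w hv hw h1 h2
  obtain ⟨u, hu, hu'⟩ := Matrix.exists_eigenvector_of_conjTranspose hv h1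
  have h3 := Matrix.riccati_closedLoop_stable hB hX h hu hu'
  have h4 := Matrix.riccati_closedLoop_stable (μ := -μ) hB hY h' hw
    (by rw [neg_smul, ← h2, Matrix.neg_mulVec, neg_neg])
  simp at h3 h4
  linarith

end Riccati

/-! ### Strictly proper rational matrix functions and their realizations. -/

section RationalFunctions

theorem constMat_mul {k l m : ℕ} (M : Matrix (Fin k) (Fin l) ℂ) (L : Matrix (Fin l) (Fin m) ℂ) :
    constMat (M * L) = constMat M * constMat L :=
  Matrix.map_mul (f := (RatFunc.C : ℂ →+* RatFunc ℂ))

theorem constMat_smul {k l : ℕ} (c : ℂ) (M : Matrix (Fin k) (Fin l) ℂ) :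
    constMat (c • M) = RatFunc.C c • constMat M := by
  ext i j
  simp [constMat]

theorem constMat_zero {k l : ℕ} : constMat (0 : Matrix (Fin k) (Fin l) ℂ) = 0 := by
  ext i j
  simp [constMat]

theorem isUnit_det_X_smul_one_sub {n : ℕ} (A : Matrix (Fin n) (Fin n) ℂ) :
    IsUnit ((RatFunc.X : RatFunc ℂ) • (1 : Matrix (Fin n) (Fin n) (RatFunc ℂ)) -
      constMat A).det := by
  have h : (RatFunc.X : RatFunc ℂ) • (1 : Matrix (Fin n) (Fin n) (RatFunc ℂ)) - constMat A
      = (algebraMap (Polynomial ℂ) (RatFunc ℂ)).mapMatrix A.charmatrix := by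
    ext i j
    by_cases hij : i = j
    · subst hij; simp [constMat]
    · simp [constMat, hij]
  rw [h, ← RingHom.map_det, isUnit_iff_ne_zero]
  exact (map_ne_zero_iff _ (RatFunc.algebraMap_injective ℂ)).2 A.charpoly_monic.ne_zero

theorem X_sub_mul_resolventMat {n : ℕ} (A : Matrix (Fin n) (Fin n) ℂ) :
    ((RatFunc.X : RatFunc ℂ) • (1 : Matrix (Fin n) (Fin n) (RatFunc ℂ)) - constMat A) *
      resolventMat A = 1 :=
  Matrix.mul_nonsing_inv _ (isUnit_det_X_smul_one_sub A)

theorem resolventMat_mul_X_sub {n : ℕ} (A : Matrix (Fin n) (Fin n) ℂ) :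
    resolventMat A *
      ((RatFunc.X : RatFunc ℂ) • (1 : Matrix (Fin n) (Fin n) (RatFunc ℂ)) - constMat A) = 1 :=
  Matrix.nonsing_inv_mul _ (isUnit_det_X_smul_one_sub A)

/-- Used both for restriction to an invariant subspace and for similarity, hence the rectangular
`P`. -/
theorem resolventMat_mul_constMat {n r : ℕ} {A : Matrix (Fin n) (Fin n) ℂ}
    {A' : Matrix (Fin r) (Fin r) ℂ} {P : Matrix (Fin n) (Fin r) ℂ} (h : A * P = P * A') :
    resolventMat A * constMat P = constMat P * resolventMat A' := by
  have h1 : ((RatFunc.X : RatFunc ℂ) • (1 : Matrix (Fin n) (Fin n) (RatFunc ℂ)) - constMat A) *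
      constMat P = constMat P *
      ((RatFunc.X : RatFunc ℂ) • (1 : Matrix (Fin r) (Fin r) (RatFunc ℂ)) - constMat A') := by
    rw [Matrix.sub_mul, Matrix.mul_sub, ← constMat_mul, ← constMat_mul, h]
    simp
  calc resolventMat A * constMat P
      = resolventMat A * (constMat P *
          ((RatFunc.X : RatFunc ℂ) • (1 : Matrix (Fin r) (Fin r) (RatFunc ℂ)) - constMat A') *
          resolventMat A') := by
        rw [Matrix.mul_assoc, X_sub_mul_resolventMat, Matrix.mul_one]
    _ = constMat P * resolventMat A' := by
        rw [← h1, Matrix.mul_assoc, ← Matrix.mul_assoc, resolventMat_mul_X_sub, Matrix.one_mul]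

theorem resolventMat_transpose {n : ℕ} (A : Matrix (Fin n) (Fin n) ℂ) :
    (resolventMat A)ᵀ = resolventMat Aᵀ := by
  unfold resolventMat
  rw [Matrix.transpose_nonsing_inv]
  congr 1
  ext i j
  simp [constMat, Matrix.one_apply, eq_comm]

theorem transferFunction_transpose {n p q : ℕ} (A : Matrix (Fin n) (Fin n) ℂ)
    (B : Matrix (Fin n) (Fin q) ℂ) (C : Matrix (Fin p) (Fin n) ℂ) :
    (constMat C * resolventMat A * constMat B)ᵀ
      = constMat Bᵀ * resolventMat Aᵀ * constMat Cᵀ := by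
  rw [Matrix.transpose_mul, Matrix.transpose_mul, resolventMat_transpose, Matrix.mul_assoc]
  rfl

-- The valuation at infinity replaces degree estimates for sums and products by ultrametric
-- inequalities.
open Classical in
theorem inftyValuation_lt_one_iff (f : RatFunc ℂ) :
    RatFunc.inftyValuation ℂ f < 1 ↔ f.num.degree < f.denom.degree := by
  by_cases hf : f = 0
  · subst hf
    simp
  · rw [RatFunc.inftyValuation_apply, RatFunc.inftyValuation_of_nonzero ℂ hf, ← WithZero.exp_zero,
      WithZero.exp_lt_exp, RatFunc.intDegree, sub_neg, Nat.cast_lt,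
      Polynomial.natDegree_lt_natDegree_iff (RatFunc.num_ne_zero hf)]

open Classical in
theorem strictlyProper_iff {p q : ℕ} (φ : Matrix (Fin p) (Fin q) (RatFunc ℂ)) :
    StrictlyProper φ ↔ ∀ i j, RatFunc.inftyValuation ℂ (φ i j) < 1 := by
  simp only [StrictlyProper, inftyValuation_lt_one_iff]

open Classical in
theorem inftyValuation_C_le_one (c : ℂ) :
    RatFunc.inftyValuation ℂ (RatFunc.C c) ≤ 1 := by
  by_cases hc : c = 0
  · simp [hc]
  · exact (RatFunc.inftyValuation.C ℂ hc).le

theorem StrictlyProper.constMat_mul {n p q : ℕ} {φ : Matrix (Fin n) (Fin q) (RatFunc ℂ)}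
    (hφ : StrictlyProper φ) (C : Matrix (Fin p) (Fin n) ℂ) : StrictlyProper (constMat C * φ) := by
  classical
  rw [strictlyProper_iff] at hφ ⊢
  intro i j
  rw [Matrix.mul_apply]
  refine Valuation.map_sum_lt _ one_ne_zero fun k _ => ?_
  rw [map_mul]
  exact (mul_le_mul_left (inftyValuation_C_le_one _) _).trans_lt (by rw [one_mul]; exact hφ k j)

/-- No determinant is needed: in `zV = AV + B` take an entry of largest valuation in a column. If
that valuation were at least `1`, the right side would not exceed it, but multiplication by `z`
strictly increases it. -/
theorem strictlyProper_resolventMat_mul {n q : ℕ} (A : Matrix (Fin n) (Fin n) ℂ)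
    (B : Matrix (Fin n) (Fin q) ℂ) : StrictlyProper (resolventMat A * constMat B) := by
  classical
  set V := resolventMat A * constMat B with hV
  have h : ((RatFunc.X : RatFunc ℂ) • (1 : Matrix (Fin n) (Fin n) (RatFunc ℂ)) - constMat A) * V
      = constMat B := by
    rw [hV, ← Matrix.mul_assoc, X_sub_mul_resolventMat, Matrix.one_mul]
  rw [strictlyProper_iff]
  intro i j
  obtain ⟨k, -, hk⟩ := Finset.exists_max_image Finset.univ
    (fun k => RatFunc.inftyValuation ℂ (V k j)) ⟨i, Finset.mem_univ i⟩
  refine lt_of_le_of_lt (hk i (Finset.mem_univ i)) ?_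
  by_contra! hge
  have hkj : RatFunc.X * V k j = (∑ l, RatFunc.C (A k l) * V l j) + RatFunc.C (B k j) := by
    have := congrFun (congrFun h k) j
    rw [Matrix.sub_mul, Matrix.sub_apply, Matrix.smul_mul, Matrix.one_mul, Matrix.smul_apply,
      smul_eq_mul, sub_eq_iff_eq_add, add_comm] at this
    exact this
  have hle : RatFunc.inftyValuation ℂ (RatFunc.X * V k j) ≤ RatFunc.inftyValuation ℂ (V k j) := by
    rw [hkj]
    refine (Valuation.map_add _ _ _).trans (max_le (Valuation.map_sum_le _ fun l _ => ?_)
      ((inftyValuation_C_le_one _).trans hge))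
    rw [map_mul]
    exact (mul_le_mul_left (inftyValuation_C_le_one _) _).trans
      (by rw [one_mul]; exact hk l (Finset.mem_univ l))
  have hpos : 0 < RatFunc.inftyValuation ℂ (V k j) := lt_of_lt_of_le zero_lt_one hge
  rw [map_mul, RatFunc.inftyValuation.X] at hle
  have h1 : (WithZero.exp (1 : ℤ)) ≤ 1 := by
    by_contra! hlt
    exact absurd hle (not_le.2 (by simpa using mul_lt_mul_of_pos_right hlt hpos))
  rw [← WithZero.exp_zero, WithZero.exp_le_exp] at h1
  norm_num at h1

theorem strictlyProper_transferFunction {n p q : ℕ} (A : Matrix (Fin n) (Fin n) ℂ)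
    (B : Matrix (Fin n) (Fin q) ℂ) (C : Matrix (Fin p) (Fin n) ℂ) :
    StrictlyProper (constMat C * resolventMat A * constMat B) := by
  rw [Matrix.mul_assoc]
  exact (strictlyProper_resolventMat_mul A B).constMat_mul C

/-- `D` is a difference of two functions vanishing at infinity, whereas a nonzero constant has
valuation `1`. -/
theorem IsStateSpaceRealization.eq_zero_of_strictlyProper {n p q : ℕ}
    {φ : Matrix (Fin p) (Fin q) (RatFunc ℂ)} {A : Matrix (Fin n) (Fin n) ℂ}
    {B : Matrix (Fin n) (Fin q) ℂ} {C : Matrix (Fin p) (Fin n) ℂ} {D : Matrix (Fin p) (Fin q) ℂ}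
    (h : IsStateSpaceRealization φ A B C D) (hφ : StrictlyProper φ) : D = 0 := by
  classical
  have h1 := strictlyProper_transferFunction A B C
  rw [strictlyProper_iff] at hφ h1
  ext i j
  by_contra hD
  have h2 : RatFunc.C (D i j) = φ i j - (constMat C * resolventMat A * constMat B) i j := by
    rw [h, Matrix.add_apply, add_sub_cancel_right]
    rfl
  have h3 := Valuation.map_sub (RatFunc.inftyValuation ℂ) (φ i j)
    ((constMat C * resolventMat A * constMat B) i j)
  rw [← h2, RatFunc.inftyValuation.C ℂ hD] at h3
  exact absurd h3 (not_le.2 (max_lt (hφ i j) (h1 i j)))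

theorem exists_companion_equation {q : Polynomial ℂ} (hq : q.Monic) :
    ∃ (a : Fin q.natDegree → Fin q.natDegree → ℂ) (b : Fin q.natDegree → ℂ),
      ∀ i : Fin q.natDegree,
      RatFunc.X * (RatFunc.X ^ (i : ℕ) / algebraMap (Polynomial ℂ) (RatFunc ℂ) q)
        - ∑ j, RatFunc.C (a i j) * (RatFunc.X ^ (j : ℕ) / algebraMap (Polynomial ℂ) (RatFunc ℂ) q)
        = RatFunc.C (b i) := by
  have hq0 : algebraMap (Polynomial ℂ) (RatFunc ℂ) q ≠ 0 :=
    (map_ne_zero_iff _ (RatFunc.algebraMap_injective ℂ)).2 hq.ne_zero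
  have hsum : algebraMap (Polynomial ℂ) (RatFunc ℂ) q = RatFunc.X ^ q.natDegree +
      ∑ j : Fin q.natDegree, RatFunc.C (q.coeff j) * RatFunc.X ^ (j : ℕ) := by
    conv_lhs => rw [hq.as_sum]
    rw [Finset.sum_range]
    simp
  -- Companion matrix: multiplication by `z` shifts `z^i/q` to the next function, and in the last
  -- row `z^(deg q)/q = 1 - ∑ q_j z^j/q`.
  refine ⟨fun i j => if (i : ℕ) + 1 < q.natDegree then (if (j : ℕ) = i + 1 then 1 else 0)
    else -q.coeff j, fun i => if (i : ℕ) + 1 < q.natDegree then 0 else 1, fun i => ?_⟩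
  by_cases hi : (i : ℕ) + 1 < q.natDegree
  · rw [Finset.sum_eq_single ⟨i + 1, hi⟩]
    · simp [hi]
      ring
    · intro j _ hj
      have : (j : ℕ) ≠ i + 1 := fun h => hj (Fin.ext h)
      simp [hi, this]
    · simp
  · have hi' : q.natDegree = i + 1 := by lia
    simp only [hi, if_false, map_one, map_neg, neg_mul, Finset.sum_neg_distrib, sub_neg_eq_add]
    rw [mul_div_assoc', ← pow_succ', ← hi']
    simp only [mul_div_assoc']
    rw [← Finset.sum_div, ← add_div, ← hsum, div_self hq0]

theorem exists_polynomial_div {f : RatFunc ℂ} (hf : f.num.degree < f.denom.degree)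
    {q : Polynomial ℂ} (hq : q.Monic) (hfq : f.denom ∣ q) :
    ∃ c : Fin q.natDegree → ℂ, f = ∑ a, RatFunc.C (c a) *
      (RatFunc.X ^ (a : ℕ) / algebraMap (Polynomial ℂ) (RatFunc ℂ) q) := by
  obtain ⟨s, rfl⟩ := hfq
  have hs : s ≠ 0 := right_ne_zero_of_mul hq.ne_zero
  have hs' : algebraMap (Polynomial ℂ) (RatFunc ℂ) s ≠ 0 :=
    (map_ne_zero_iff _ (RatFunc.algebraMap_injective ℂ)).2 hs
  refine ⟨fun a => (f.num * s).coeff a, ?_⟩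
  have hdeg : (f.num * s).degree < ((f.denom * s).natDegree : WithBot ℕ) := by
    rw [← Polynomial.degree_eq_natDegree hq.ne_zero, Polynomial.degree_mul, Polynomial.degree_mul]
    exact WithBot.add_lt_add_right (Polynomial.degree_ne_bot.2 hs) hf
  have hsum : algebraMap (Polynomial ℂ) (RatFunc ℂ) (f.num * s) =
      ∑ a : Fin (f.denom * s).natDegree, RatFunc.C ((f.num * s).coeff a) *
        RatFunc.X ^ (a : ℕ) := by
    have : f.num * s = ∑ a ∈ Finset.range (f.denom * s).natDegree,
        Polynomial.C ((f.num * s).coeff a) * Polynomial.X ^ a := by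
      by_cases h0 : f.num * s = 0
      · simp [h0]
      · exact Polynomial.as_sum_range_C_mul_X_pow' _
          ((Polynomial.natDegree_lt_iff_degree_lt h0).2 hdeg)
    conv_lhs => rw [this]
    rw [Finset.sum_range]
    simp
  simp only [mul_div_assoc']
  rw [← Finset.sum_div, ← hsum, map_mul, map_mul, mul_div_mul_right _ _ hs', RatFunc.num_div_denom]

/-- A solution of `(z - A)V = B` is the resolvent times `B`, so no inverse has to be computed. The
free index type admits pairs as states. -/
theorem exists_realization_of_equation {ι : Type*} [Fintype ι] [DecidableEq ι] {p q : ℕ}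
    {φ : Matrix (Fin p) (Fin q) (RatFunc ℂ)} (A : ι → ι → ℂ) (B : ι → Fin q → ℂ)
    (C : Fin p → ι → ℂ) (V : ι → Fin q → RatFunc ℂ)
    (hV : ∀ k j, RatFunc.X * V k j - ∑ l, RatFunc.C (A k l) * V l j = RatFunc.C (B k j))
    (hφ : ∀ i j, φ i j = ∑ k, RatFunc.C (C i k) * V k j) :
    ∃ (n : ℕ) (A : Matrix (Fin n) (Fin n) ℂ) (B : Matrix (Fin n) (Fin q) ℂ)
      (C : Matrix (Fin p) (Fin n) ℂ), φ = constMat C * resolventMat A * constMat B := by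
  let e := (Fintype.equivFin ι).symm
  refine ⟨Fintype.card ι, Matrix.of fun k l => A (e k) (e l), Matrix.of fun k j => B (e k) j,
    Matrix.of fun i k => C i (e k), ?_⟩
  set A' : Matrix _ _ ℂ := Matrix.of fun k l => A (e k) (e l)
  set V' : Matrix (Fin (Fintype.card ι)) (Fin q) (RatFunc ℂ) := Matrix.of fun k j => V (e k) j
  have h1 : ((RatFunc.X : RatFunc ℂ) • (1 : Matrix _ _ (RatFunc ℂ)) - constMat A') * V'
      = constMat (Matrix.of fun k j => B (e k) j) := by
    ext k j
    rw [Matrix.sub_mul, Matrix.smul_mul, Matrix.one_mul]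
    change RatFunc.X * V (e k) j - ∑ l, RatFunc.C (A (e k) (e l)) * V (e l) j = RatFunc.C (B (e k) j)
    rw [← hV, Equiv.sum_comp e fun l => RatFunc.C (A (e k) l) * V l j]
  rw [Matrix.mul_assoc, ← h1, ← Matrix.mul_assoc (resolventMat A'), resolventMat_mul_X_sub,
    Matrix.one_mul]
  ext i j
  rw [hφ]
  exact (Equiv.sum_comp e fun k => RatFunc.C (C i k) * V k j).symm

theorem exists_monic_common_multiple {R ι : Type*} [CommRing R] [Fintype ι]
    (f : ι → Polynomial R) (hf : ∀ i, (f i).Monic) :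
    ∃ d : Polynomial R, d.Monic ∧ ∀ i, f i ∣ d :=
  ⟨∏ i, f i, Polynomial.monic_prod_of_monic _ _ fun i _ => hf i, fun i =>
    Finset.dvd_prod_of_mem f (Finset.mem_univ i)⟩

/-- A strictly proper rational matrix function has a state space realization. -/
theorem StrictlyProper.exists_realization {p q : ℕ} {φ : Matrix (Fin p) (Fin q) (RatFunc ℂ)}
    (hφ : StrictlyProper φ) :
    ∃ (n : ℕ) (A : Matrix (Fin n) (Fin n) ℂ) (B : Matrix (Fin n) (Fin q) ℂ)
      (C : Matrix (Fin p) (Fin n) ℂ), φ = constMat C * resolventMat A * constMat B := by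
  obtain ⟨d, hmonic, hdvd⟩ : ∃ d : Polynomial ℂ, d.Monic ∧ ∀ i j, (φ i j).denom ∣ d :=
    (exists_monic_common_multiple (fun x : Fin p × Fin q => (φ x.1 x.2).denom)
      fun _ => RatFunc.monic_denom _).imp fun d hd => ⟨hd.1, fun i j => hd.2 (i, j)⟩
  obtain ⟨a, b, hab⟩ := exists_companion_equation hmonic
  choose c hc using fun i j => exists_polynomial_div (hφ i j) hmonic (hdvd i j)
  -- One copy of the companion system of the common denominator for each input column.
  refine exists_realization_of_equation (ι := Fin d.natDegree × Fin q)
    (fun k l => if k.2 = l.2 then a k.1 l.1 else 0) (fun k j => if k.2 = j then b k.1 else 0)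
    (fun i k => c i k.2 k.1)
    (fun k j => if k.2 = j then RatFunc.X ^ (k.1 : ℕ) /
      algebraMap (Polynomial ℂ) (RatFunc ℂ) d else 0) ?_ ?_
  · rintro ⟨k, l⟩ j
    rw [Fintype.sum_prod_type]
    by_cases hlj : l = j
    · subst hlj
      simp only [if_true]
      rw [← hab]
      congr 1
      refine Finset.sum_congr rfl fun x _ => ?_
      rw [Finset.sum_eq_single l (by intro y _ hy; simp [hy]) (by simp)]
      simp
    · simp only [hlj, if_false, mul_zero, map_zero, zero_sub, neg_eq_zero]
      refine Finset.sum_eq_zero fun x _ => Finset.sum_eq_zero fun y _ => ?_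
      by_cases hly : l = y
      · subst hly; simp [hlj]
      · simp [hly]
  · intro i j
    rw [Fintype.sum_prod_type, hc i j]
    refine Finset.sum_congr rfl fun x _ => ?_
    rw [Finset.sum_eq_single j (by intro y _ hy; simp [hy]) (by simp)]
    simp

end RationalFunctions

/-! ### Minimality and controllability. -/

section Realizations

/-- The hyperplane orthogonal to `y` is `A`-invariant and contains the range of `B`, so the system
restricts to it. -/
theorem exists_smaller_realization {n p q : ℕ} {A : Matrix (Fin n) (Fin n) ℂ}
    {B : Matrix (Fin n) (Fin q) ℂ} (C : Matrix (Fin p) (Fin n) ℂ) {μ : ℂ} {y : Fin n → ℂ}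
    (hy : y ≠ 0) (hA : Aᴴ *ᵥ y = μ • y) (hB : Bᴴ *ᵥ y = 0) :
    ∃ (r : ℕ) (_ : r < n) (A' : Matrix (Fin r) (Fin r) ℂ) (B' : Matrix (Fin r) (Fin q) ℂ)
      (C' : Matrix (Fin p) (Fin r) ℂ),
      constMat C * resolventMat A * constMat B = constMat C' * resolventMat A' * constMat B' := by
  let W : Submodule ℂ (Fin n → ℂ) := LinearMap.ker (dotProductBilin ℂ ℂ (star y))
  have hW : ∀ v, v ∈ W ↔ star y ⬝ᵥ v = 0 := fun v => LinearMap.mem_ker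
  have hr : Module.finrank ℂ W < n := by
    have := Submodule.finrank_lt (s := W) (by
      intro htop
      have h1 : y ∈ W := htop ▸ Submodule.mem_top
      rw [hW, dotProduct_star_self_eq_zero] at h1
      exact hy h1)
    simpa using this
  obtain ⟨P, -, hPW, hPex⟩ := W.exists_matrix_basis rfl
  obtain ⟨A', hA'⟩ := hPex _ (A * P) (by
    intro v
    have := hPW v
    rw [hW] at this ⊢
    rw [← Matrix.mulVec_mulVec, Matrix.dotProduct_mulVec, ← Matrix.conjTranspose_conjTranspose A,
      ← Matrix.star_mulVec, hA, star_smul, smul_dotProduct, this, smul_zero])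
  obtain ⟨B', hB'⟩ := hPex _ B (by
    intro v
    rw [hW, Matrix.dotProduct_mulVec, ← Matrix.conjTranspose_conjTranspose B,
      ← Matrix.star_mulVec, hB, star_zero, zero_dotProduct])
  refine ⟨_, hr, A', B', C * P, ?_⟩
  rw [constMat_mul, hB', constMat_mul, ← Matrix.mul_assoc, Matrix.mul_assoc _ (resolventMat A),
    resolventMat_mul_constMat hA', Matrix.mul_assoc (constMat C) (constMat P)]

theorem realizationFun_eq {n m₁ m₂ : ℕ} (γ : Matrix (Fin n) (Fin n) ℂ)
    (θ₁ : Matrix (Fin n) (Fin m₁) ℂ) (θ₂ : Matrix (Fin n) (Fin m₂) ℂ) :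
    realizationFun γ θ₁ θ₂
      = constMat (Complex.I • θ₂ᴴ) * resolventMat γ * constMat θ₁ := by
  rw [realizationFun, constMat_smul, Matrix.smul_mul, Matrix.smul_mul]

theorem mcMillanDegree_le {n p q : ℕ} {φ : Matrix (Fin p) (Fin q) (RatFunc ℂ)}
    {A : Matrix (Fin n) (Fin n) ℂ} {B : Matrix (Fin n) (Fin q) ℂ} {C : Matrix (Fin p) (Fin n) ℂ}
    (h : φ = constMat C * resolventMat A * constMat B) : mcMillanDegree φ ≤ n :=
  Nat.sInf_le ⟨A, B, C, 0, by rw [IsStateSpaceRealization, constMat_zero, zero_add, h]⟩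

theorem StrictlyProper.exists_minimalRealization {m₁ m₂ : ℕ}
    {φ : Matrix (Fin m₂) (Fin m₁) (RatFunc ℂ)} (hφ : StrictlyProper φ) :
    ∃ (γ : Matrix (Fin (mcMillanDegree φ)) (Fin (mcMillanDegree φ)) ℂ)
      (θ₁ : Matrix (Fin (mcMillanDegree φ)) (Fin m₁) ℂ)
      (θ₂ : Matrix (Fin (mcMillanDegree φ)) (Fin m₂) ℂ), IsMinimalRealization φ γ θ₁ θ₂ := by
  obtain ⟨A, B, C, D, h⟩ : mcMillanDegree φ ∈ {n : ℕ | ∃ (A : Matrix (Fin n) (Fin n) ℂ)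
      (B : Matrix (Fin n) (Fin m₁) ℂ) (C : Matrix (Fin m₂) (Fin n) ℂ)
      (D : Matrix (Fin m₂) (Fin m₁) ℂ), IsStateSpaceRealization φ A B C D} := by
    refine Nat.sInf_mem ?_
    obtain ⟨n, A, B, C, h⟩ := hφ.exists_realization
    exact ⟨n, A, B, C, 0, by rw [IsStateSpaceRealization, constMat_zero, zero_add, h]⟩
  have hD := h.eq_zero_of_strictlyProper hφ
  rw [hD, IsStateSpaceRealization, constMat_zero, zero_add] at h
  -- Chosen so that `i(iC*)* = C`.
  refine ⟨A, B, Complex.I • Cᴴ, rfl, ?_⟩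
  rw [realizationFun_eq, Matrix.conjTranspose_smul, Matrix.conjTranspose_conjTranspose, smul_smul]
  simpa using h

theorem IsMinimalRealization.controllable {n m₁ m₂ : ℕ}
    {φ : Matrix (Fin m₂) (Fin m₁) (RatFunc ℂ)} {γ : Matrix (Fin n) (Fin n) ℂ}
    {θ₁ : Matrix (Fin n) (Fin m₁) ℂ} {θ₂ : Matrix (Fin n) (Fin m₂) ℂ}
    (h : IsMinimalRealization φ γ θ₁ θ₂) (μ : ℂ) (y : Fin n → ℂ) (hγ : γᴴ *ᵥ y = μ • y)
    (hθ : θ₁ᴴ *ᵥ y = 0) : y = 0 := by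
  by_contra hy
  obtain ⟨r, hr, A', B', C', h'⟩ :=
    exists_smaller_realization (Complex.I • θ₂ᴴ) hy hγ hθ
  rw [← realizationFun_eq, ← h.2] at h'
  have := mcMillanDegree_le h'
  rw [← h.1] at this
  lia

/-- Dual to controllability by transposing the realization; the eigenvector gets conjugated because
`(Mᵀ)ᴴ` is the entrywise conjugate of `M`. -/
theorem IsMinimalRealization.observable {n m₁ m₂ : ℕ}
    {φ : Matrix (Fin m₂) (Fin m₁) (RatFunc ℂ)} {γ : Matrix (Fin n) (Fin n) ℂ}
    {θ₁ : Matrix (Fin n) (Fin m₁) ℂ} {θ₂ : Matrix (Fin n) (Fin m₂) ℂ}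
    (h : IsMinimalRealization φ γ θ₁ θ₂) (μ : ℂ) (x : Fin n → ℂ) (hγ : γ *ᵥ x = μ • x)
    (hθ : θ₂ᴴ *ᵥ x = 0) : x = 0 := by
  by_contra hx
  have hconj : ∀ {k : ℕ} (M : Matrix (Fin k) (Fin n) ℂ), Mᵀᴴ *ᵥ star x = star (M *ᵥ x) := by
    intro k M
    rw [Matrix.star_mulVec, ← Matrix.mulVec_transpose, Matrix.conjTranspose_transpose]
    rfl
  obtain ⟨r, hr, A', B', C', h'⟩ :=
    exists_smaller_realization (A := γᵀ) (B := (Complex.I • θ₂ᴴ)ᵀ) (μ := star μ) (y := star x)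
      θ₁ᵀ (fun h0 => hx (by simpa using h0)) (by rw [hconj, hγ, star_smul])
      (by rw [hconj, Matrix.smul_mulVec, hθ, smul_zero, star_zero])
  have h2 := congrArg Matrix.transpose h'
  rw [transferFunction_transpose, transferFunction_transpose, Matrix.transpose_transpose,
    Matrix.transpose_transpose, Matrix.transpose_transpose, ← realizationFun_eq, ← h.2] at h2
  have := mcMillanDegree_le h2
  rw [← h.1] at this
  lia

/-- The eigenvector test for controllability. -/
theorem isControllablePair_of_eigenvector_test {n k : ℕ} {A : Matrix (Fin n) (Fin n) ℂ}
    {B : Matrix (Fin n) (Fin k) ℂ}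
    (h : ∀ (μ : ℂ) (y : Fin n → ℂ), Aᴴ *ᵥ y = μ • y → Bᴴ *ᵥ y = 0 → y = 0) :
    IsControllablePair A B := by
  by_contra hne
  obtain ⟨f, hf0, hf⟩ := Submodule.exists_le_ker_of_lt_top _ (lt_top_iff_ne_top.2 hne)
  obtain ⟨y, hy⟩ : ∃ y : Fin n → ℂ, ∀ v, f v = star y ⬝ᵥ v := by
    refine ⟨star fun i => f (Pi.single i 1), fun v => ?_⟩
    rw [star_star, dotProduct, LinearMap.pi_apply_eq_sum_univ f v]
    refine Finset.sum_congr rfl fun i _ => ?_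
    rw [smul_eq_mul, mul_comm]
    congr 2
    ext j
    simp [Pi.single_apply, eq_comm]
  have hy0 : y ≠ 0 := by
    rintro rfl
    exact hf0 (LinearMap.ext fun v => by simp [hy])
  have hn : 0 < n := by
    rcases Nat.eq_zero_or_pos n with rfl | hn
    · exact absurd (Subsingleton.elim _ _) hy0
    · exact hn
  have hlow : ∀ i < n, (A ^ i * B)ᴴ *ᵥ y = 0 := by
    intro i hi
    rw [← star_eq_zero, Matrix.star_mulVec, Matrix.conjTranspose_conjTranspose]
    refine dotProduct_eq_zero _ fun v => ?_
    rw [← Matrix.dotProduct_mulVec, ← hy]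
    exact hf (Submodule.mem_iSup_of_mem (⟨i, hi⟩ : Fin n) ⟨v, rfl⟩)
  -- Cayley–Hamilton extends the vanishing from the powers below `n` to all powers, which makes `U`
  -- below invariant under `A*`.
  have hall : ∀ i : ℕ, (A ^ i * B)ᴴ *ᵥ y = 0 := by
    intro i
    have hdeg : (Polynomial.X ^ i %ₘ A.charpoly).natDegree < n := by
      have h1 := Polynomial.natDegree_modByMonic_lt (Polynomial.X ^ i) A.charpoly_monic (by
        intro h1
        have := A.charpoly_natDegree_eq_dim
        rw [h1, Polynomial.natDegree_one, Fintype.card_fin] at this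
        lia)
      rwa [A.charpoly_natDegree_eq_dim, Fintype.card_fin] at h1
    rw [Matrix.pow_eq_aeval_mod_charpoly, Polynomial.aeval_eq_sum_range' hdeg, Matrix.sum_mul,
      Matrix.conjTranspose_sum, Matrix.sum_mulVec]
    refine Finset.sum_eq_zero fun j hj => ?_
    rw [Matrix.smul_mul, Matrix.conjTranspose_smul, Matrix.smul_mulVec,
      hlow j (Finset.mem_range.1 hj), smul_zero]
  let U : Submodule ℂ (Fin n → ℂ) := ⨅ i : ℕ, LinearMap.ker ((A ^ i * B)ᴴ).mulVecLin
  have hU : ∀ v, v ∈ U ↔ ∀ i : ℕ, (A ^ i * B)ᴴ *ᵥ v = 0 := by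
    intro v
    simp [U, Submodule.mem_iInf]
  obtain ⟨μ, v, hvU, hv0, hv⟩ := Matrix.exists_eigenvector_mem Aᴴ U
    (fun hbot => hy0 (by
      have : y ∈ U := (hU y).2 hall
      rwa [hbot, Submodule.mem_bot] at this)) (by
      intro v hv
      rw [hU] at hv ⊢
      intro i
      rw [Matrix.mulVec_mulVec, ← Matrix.conjTranspose_mul, ← Matrix.mul_assoc, ← pow_succ']
      exact hv (i + 1))
  exact hv0 (h μ v hv (by simpa using (hU v).1 hvU 0))

end Realizations

/-! ### The quadruple built from the Riccati solution. -/

section RecoveredQuadruple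

variable {n m₁ m₂ : ℕ} {γ X : Matrix (Fin n) (Fin n) ℂ} {θ₁ : Matrix (Fin n) (Fin m₁) ℂ}
  {θ₂ : Matrix (Fin n) (Fin m₂) ℂ}

/-- Multiplication by `-i` gives the control-theoretic form with `A = -iγ`, `B = θ₁`, `C = θ₂*`. -/
theorem isPosDefRiccatiSolution_iff : IsPosDefRiccatiSolution γ θ₁ θ₂ X ↔ X.PosDef ∧
    (-Complex.I • γ) * X + X * (-Complex.I • γ)ᴴ - X * (θ₂ᴴᴴ * θ₂ᴴ) * X + θ₁ * θ₁ᴴ = 0 := by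
  refine and_congr_right fun _ => ?_
  have e : (-Complex.I • γ) * X + X * (-Complex.I • γ)ᴴ - X * (θ₂ᴴᴴ * θ₂ᴴ) * X + θ₁ * θ₁ᴴ
      = -Complex.I • (γ * X - X * γᴴ - Complex.I • (X * θ₂ * θ₂ᴴ * X)
        + Complex.I • (θ₁ * θ₁ᴴ)) := by
    have hconj : (-Complex.I • γ)ᴴ = Complex.I • γᴴ := by
      rw [Matrix.conjTranspose_smul, star_neg, Complex.star_def, Complex.conj_I, neg_neg]
    rw [hconj]
    simp only [Matrix.conjTranspose_conjTranspose, Matrix.smul_mul, Matrix.mul_smul, smul_add, smul_sub,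
      smul_smul, neg_neg, neg_smul, neg_mul, Complex.I_mul_I, one_smul, Matrix.mul_assoc]
    abel
  rw [e, smul_eq_zero]
  simp

theorem existsUnique_posDefRiccatiSolution
    (h₁ : ∀ (μ : ℂ) (y : Fin n → ℂ), γᴴ *ᵥ y = μ • y → θ₁ᴴ *ᵥ y = 0 → y = 0)
    (h₂ : ∀ (μ : ℂ) (x : Fin n → ℂ), γ *ᵥ x = μ • x → θ₂ᴴ *ᵥ x = 0 → x = 0) :
    ∃! X : Matrix (Fin n) (Fin n) ℂ, IsPosDefRiccatiSolution γ θ₁ θ₂ X := by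
  have hB : ∀ (μ : ℂ) (y : Fin n → ℂ), (-Complex.I • γ)ᴴ *ᵥ y = μ • y → θ₁ᴴ *ᵥ y = 0 → y = 0 := by
    intro μ y hy
    refine h₁ (-Complex.I * μ) y ?_
    rw [← smul_smul, ← hy, Matrix.conjTranspose_smul, Matrix.smul_mulVec, smul_smul]
    simp
  have hC : ∀ (μ : ℂ) (x : Fin n → ℂ), (-Complex.I • γ) *ᵥ x = μ • x → θ₂ᴴ *ᵥ x = 0 → x = 0 := by
    intro μ x hx
    refine h₂ (Complex.I * μ) x ?_
    rw [← smul_smul, ← hx, Matrix.smul_mulVec, smul_smul]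
    simp
  obtain ⟨X, hX, hric⟩ := Matrix.exists_posDef_riccati hB hC
  refine ⟨X, isPosDefRiccatiSolution_iff.2 ⟨hX, hric⟩, fun Y hY => ?_⟩
  obtain ⟨hY, hric'⟩ := isPosDefRiccatiSolution_iff.1 hY
  exact Matrix.posDef_riccati_unique hB hY hric' hX hric

theorem Matrix.PosDef.cfcSqrt_mul_self (hX : X.PosDef) : CFC.sqrt X * CFC.sqrt X = X :=
  CFC.sqrt_mul_sqrt_self X (Matrix.nonneg_iff_posSemidef.2 hX.posSemidef)

theorem Matrix.conjTranspose_cfcSqrt (X : Matrix (Fin n) (Fin n) ℂ) :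
    (CFC.sqrt X)ᴴ = CFC.sqrt X :=
  (Matrix.nonneg_iff_posSemidef.1 (CFC.sqrt_nonneg X)).isHermitian.eq

theorem Matrix.PosDef.isUnit_det_cfcSqrt (hX : X.PosDef) : IsUnit (CFC.sqrt X).det := by
  have h : IsUnit X.det := (Matrix.isUnit_iff_isUnit_det _).1 hX.isUnit
  rw [← hX.cfcSqrt_mul_self, Matrix.det_mul] at h
  exact isUnit_of_mul_isUnit_left h

theorem recoveredQuadruple_β₁ :
    (recoveredQuadruple γ θ₁ θ₂ X).β₁ = (CFC.sqrt X)⁻¹ * γ * CFC.sqrt X := by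
  simp [Quadruple.β₁, recoveredQuadruple]

theorem recoveredQuadruple_α : (recoveredQuadruple γ θ₁ θ₂ X).α = (CFC.sqrt X)⁻¹ * γ * CFC.sqrt X +
    Complex.I • (((CFC.sqrt X)⁻¹ * θ₁) * ((CFC.sqrt X)⁻¹ * θ₁)ᴴ) := rfl

/-- This is the Riccati equation multiplied by `X^(-1/2)` on both sides. -/
theorem IsPosDefRiccatiSolution.recoveredQuadruple_α_sub (h : IsPosDefRiccatiSolution γ θ₁ θ₂ X) :
    (recoveredQuadruple γ θ₁ θ₂ X).α - (recoveredQuadruple γ θ₁ θ₂ X).αᴴ = Complex.I •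
      (((CFC.sqrt X)⁻¹ * θ₁) * ((CFC.sqrt X)⁻¹ * θ₁)ᴴ +
        (CFC.sqrt X * θ₂) * (CFC.sqrt X * θ₂)ᴴ) := by
  obtain ⟨hX, hric⟩ := h
  have hS := hX.cfcSqrt_mul_self
  have hSh := Matrix.conjTranspose_cfcSqrt X
  have hdet := hX.isUnit_det_cfcSqrt
  rw [recoveredQuadruple_α]
  set S := CFC.sqrt X
  have hi : S * S⁻¹ = 1 := Matrix.mul_nonsing_inv _ hdet
  have hi' : S⁻¹ * S = 1 := Matrix.nonsing_inv_mul _ hdet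
  have hSi : (S⁻¹)ᴴ = S⁻¹ := by rw [Matrix.conjTranspose_nonsing_inv, hSh]
  have key := congrArg (fun M => S⁻¹ * M * S⁻¹) hric
  simp only [Matrix.mul_zero, Matrix.zero_mul] at key
  rw [← hS] at key
  have e : S⁻¹ * (γ * (S * S) - S * S * γᴴ - Complex.I • (S * S * θ₂ * θ₂ᴴ * (S * S)) +
      Complex.I • (θ₁ * θ₁ᴴ)) * S⁻¹ = S⁻¹ * γ * S * (S * S⁻¹) - (S⁻¹ * S) * S * γᴴ * S⁻¹
      - Complex.I • ((S⁻¹ * S) * S * θ₂ * θ₂ᴴ * S * (S * S⁻¹))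
      + Complex.I • (S⁻¹ * θ₁ * θ₁ᴴ * S⁻¹) := by
    simp only [Matrix.mul_add, Matrix.mul_sub, Matrix.add_mul, Matrix.sub_mul, Matrix.mul_smul,
      Matrix.smul_mul, Matrix.mul_assoc]
  rw [e, hi, hi', Matrix.mul_one, Matrix.one_mul, Matrix.mul_one] at key
  simp only [Matrix.conjTranspose_add, Matrix.conjTranspose_smul, Matrix.conjTranspose_mul,
    Matrix.conjTranspose_conjTranspose, hSi, hSh, Complex.star_def, Complex.conj_I, neg_smul]
  rw [← sub_eq_zero, ← key]
  simp only [Matrix.mul_assoc, smul_add]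
  abel

theorem IsPosDefRiccatiSolution.isAdmissible (h : IsPosDefRiccatiSolution γ θ₁ θ₂ X) :
    (recoveredQuadruple γ θ₁ θ₂ X).IsAdmissible := by
  refine ⟨Matrix.PosDef.one, ?_⟩
  have h1 := h.recoveredQuadruple_α_sub
  change _ * 1 - 1 * _ = _
  rw [Matrix.mul_one, Matrix.one_mul, h1, Quadruple.Λ,
    Matrix.conjTranspose_fromCols_eq_fromRows_conjTranspose, Matrix.fromCols_mul_fromRows]
  rfl

theorem IsPosDefRiccatiSolution.φ₁_recoveredQuadruple (h : IsPosDefRiccatiSolution γ θ₁ θ₂ X) :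
    (recoveredQuadruple γ θ₁ θ₂ X).φ₁ = realizationFun γ θ₁ θ₂ := by
  have hdet := h.1.isUnit_det_cfcSqrt
  have hi : CFC.sqrt X * (CFC.sqrt X)⁻¹ = 1 := Matrix.mul_nonsing_inv _ hdet
  have hcomm : γ * CFC.sqrt X = CFC.sqrt X * ((CFC.sqrt X)⁻¹ * γ * CFC.sqrt X) := by
    rw [← Matrix.mul_assoc, ← Matrix.mul_assoc, hi, Matrix.one_mul]
  rw [Quadruple.φ₁, realizationFun, recoveredQuadruple_β₁]
  change RatFunc.C Complex.I • (constMat ((CFC.sqrt X * θ₂)ᴴ * 1⁻¹) * _ *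
    constMat ((CFC.sqrt X)⁻¹ * θ₁)) = _
  rw [inv_one, Matrix.mul_one, Matrix.conjTranspose_mul, Matrix.conjTranspose_cfcSqrt,
    constMat_mul, Matrix.mul_assoc (constMat θ₂ᴴ), ← resolventMat_mul_constMat hcomm,
    Matrix.mul_assoc, Matrix.mul_assoc, ← constMat_mul, ← Matrix.mul_assoc (CFC.sqrt X), hi,
    Matrix.one_mul, ← Matrix.mul_assoc]

/-- On `ker ϑ₁*` the matrices `α*` and `β₁*` agree, so an eigenvector `y` there yields the
eigenvector `X^(-1/2)y` of `γ*` in `ker θ₁*`. -/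
theorem IsPosDefRiccatiSolution.isControllablePair_ϑ₁ (h : IsPosDefRiccatiSolution γ θ₁ θ₂ X)
    (h₁ : ∀ (μ : ℂ) (y : Fin n → ℂ), γᴴ *ᵥ y = μ • y → θ₁ᴴ *ᵥ y = 0 → y = 0) :
    IsControllablePair (recoveredQuadruple γ θ₁ θ₂ X).α (recoveredQuadruple γ θ₁ θ₂ X).ϑ₁ := by
  have hSh := Matrix.conjTranspose_cfcSqrt X
  have hdet := h.1.isUnit_det_cfcSqrt
  refine isControllablePair_of_eigenvector_test fun μ y hα hϑ => ?_
  rw [recoveredQuadruple_α] at hα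
  change ((CFC.sqrt X)⁻¹ * θ₁)ᴴ *ᵥ y = 0 at hϑ
  set S := CFC.sqrt X
  have hi : S * S⁻¹ = 1 := Matrix.mul_nonsing_inv _ hdet
  have hi' : S⁻¹ * S = 1 := Matrix.nonsing_inv_mul _ hdet
  have hSi : (S⁻¹)ᴴ = S⁻¹ := by rw [Matrix.conjTranspose_nonsing_inv, hSh]
  rw [Matrix.conjTranspose_add, Matrix.conjTranspose_smul, Matrix.conjTranspose_mul (S⁻¹ * θ₁),
    Matrix.conjTranspose_conjTranspose, Matrix.add_mulVec, Matrix.smul_mulVec,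
    ← Matrix.mulVec_mulVec, hϑ, Matrix.mulVec_zero, smul_zero, add_zero, Matrix.conjTranspose_mul,
    Matrix.conjTranspose_mul, hSh, hSi] at hα
  rw [Matrix.conjTranspose_mul, hSi, ← Matrix.mulVec_mulVec] at hϑ
  have hz := h₁ μ (S⁻¹ *ᵥ y) (by
    rw [← Matrix.mulVec_smul, ← hα, Matrix.mulVec_mulVec, Matrix.mulVec_mulVec,
      ← Matrix.mul_assoc, hi', Matrix.one_mul]) hϑ
  rw [← Matrix.one_mulVec y, ← hi, ← Matrix.mulVec_mulVec, hz, Matrix.mulVec_zero]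

/-- The admissibility identity gives `β₁ = α* + iϑ₂ϑ₂*`, so `α*` and `β₁` agree on `ker ϑ₂*`.
Controllability of `{α, ϑ₂}` therefore comes from observability of the realization, through the
vector `X^(1/2)y`. -/
theorem IsPosDefRiccatiSolution.isControllablePair_ϑ₂ (h : IsPosDefRiccatiSolution γ θ₁ θ₂ X)
    (h₂ : ∀ (μ : ℂ) (x : Fin n → ℂ), γ *ᵥ x = μ • x → θ₂ᴴ *ᵥ x = 0 → x = 0) :
    IsControllablePair (recoveredQuadruple γ θ₁ θ₂ X).α (recoveredQuadruple γ θ₁ θ₂ X).ϑ₂ := by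
  have hSh := Matrix.conjTranspose_cfcSqrt X
  have hdet := h.1.isUnit_det_cfcSqrt
  have hsub := h.recoveredQuadruple_α_sub
  refine isControllablePair_of_eigenvector_test fun μ y hα hϑ => ?_
  change (CFC.sqrt X * θ₂)ᴴ *ᵥ y = 0 at hϑ
  have hβ : ((CFC.sqrt X)⁻¹ * γ * CFC.sqrt X) *ᵥ y = μ • y := by
    have e : (CFC.sqrt X)⁻¹ * γ * CFC.sqrt X = (recoveredQuadruple γ θ₁ θ₂ X).αᴴ +
        Complex.I • ((CFC.sqrt X * θ₂) * (CFC.sqrt X * θ₂)ᴴ) := by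
      rw [sub_eq_iff_eq_add, recoveredQuadruple_α (γ := γ), smul_add] at hsub
      rw [recoveredQuadruple_α, ← sub_eq_zero, ← sub_eq_zero.2 hsub]
      abel
    rw [e, Matrix.add_mulVec, hα, Matrix.smul_mulVec, ← Matrix.mulVec_mulVec, hϑ,
      Matrix.mulVec_zero, smul_zero, add_zero]
  set S := CFC.sqrt X
  have hi : S * S⁻¹ = 1 := Matrix.mul_nonsing_inv _ hdet
  have hi' : S⁻¹ * S = 1 := Matrix.nonsing_inv_mul _ hdet
  have hz := h₂ μ (S *ᵥ y) (by
    rw [← Matrix.mulVec_smul, ← hβ, Matrix.mulVec_mulVec, Matrix.mulVec_mulVec,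
      ← Matrix.mul_assoc, ← Matrix.mul_assoc, hi, Matrix.one_mul]) (by
    rwa [Matrix.conjTranspose_mul, hSh, ← Matrix.mulVec_mulVec] at hϑ)
  rw [← Matrix.one_mulVec y, ← hi', ← Matrix.mulVec_mulVec, hz, Matrix.mulVec_zero]

end RecoveredQuadruple

theorem Quadruple.strictlyProper_φ₁ {n m₁ m₂ : ℕ} (Q : Quadruple n m₁ m₂) :
    StrictlyProper Q.φ₁ := by
  rw [Quadruple.φ₁, ← Matrix.smul_mul, ← Matrix.smul_mul, ← constMat_smul]
  exact strictlyProper_transferFunction _ _ _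


theorem theoremA3 {m₁ m₂ : ℕ} (φ : Matrix (Fin m₂) (Fin m₁) (RatFunc ℂ)) :
    ((∃ (n : ℕ) (Q : Quadruple n m₁ m₂), Q.IsAdmissible ∧ φ = Q.φ₁) ↔ StrictlyProper φ) ∧
    (StrictlyProper φ → ∀ n : ℕ, n = mcMillanDegree φ →
      (∃ (γ : Matrix (Fin n) (Fin n) ℂ) (θ₁ : Matrix (Fin n) (Fin m₁) ℂ)
        (θ₂ : Matrix (Fin n) (Fin m₂) ℂ), IsMinimalRealization φ γ θ₁ θ₂) ∧
      ∀ (γ : Matrix (Fin n) (Fin n) ℂ) (θ₁ : Matrix (Fin n) (Fin m₁) ℂ)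
        (θ₂ : Matrix (Fin n) (Fin m₂) ℂ), IsMinimalRealization φ γ θ₁ θ₂ →
        (∃! X : Matrix (Fin n) (Fin n) ℂ, IsPosDefRiccatiSolution γ θ₁ θ₂ X) ∧
        ∀ X : Matrix (Fin n) (Fin n) ℂ, IsPosDefRiccatiSolution γ θ₁ θ₂ X →
          (recoveredQuadruple γ θ₁ θ₂ X).IsAdmissible ∧
          φ = (recoveredQuadruple γ θ₁ θ₂ X).φ₁ ∧
          IsControllablePair (recoveredQuadruple γ θ₁ θ₂ X).α (recoveredQuadruple γ θ₁ θ₂ X).ϑ₁ ∧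
          IsControllablePair (recoveredQuadruple γ θ₁ θ₂ X).α
            (recoveredQuadruple γ θ₁ θ₂ X).ϑ₂) := by

  have main : ∀ (n : ℕ) (γ : Matrix (Fin n) (Fin n) ℂ) (θ₁ : Matrix (Fin n) (Fin m₁) ℂ)
      (θ₂ : Matrix (Fin n) (Fin m₂) ℂ), IsMinimalRealization φ γ θ₁ θ₂ →
      (∃! X : Matrix (Fin n) (Fin n) ℂ, IsPosDefRiccatiSolution γ θ₁ θ₂ X) ∧
      ∀ X : Matrix (Fin n) (Fin n) ℂ, IsPosDefRiccatiSolution γ θ₁ θ₂ X →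
        (recoveredQuadruple γ θ₁ θ₂ X).IsAdmissible ∧
        φ = (recoveredQuadruple γ θ₁ θ₂ X).φ₁ ∧
        IsControllablePair (recoveredQuadruple γ θ₁ θ₂ X).α (recoveredQuadruple γ θ₁ θ₂ X).ϑ₁ ∧
        IsControllablePair (recoveredQuadruple γ θ₁ θ₂ X).α
          (recoveredQuadruple γ θ₁ θ₂ X).ϑ₂ :=
    fun n γ θ₁ θ₂ h => ⟨existsUnique_posDefRiccatiSolution h.controllable h.observable,
      fun X hX => ⟨hX.isAdmissible, h.2.trans hX.φ₁_recoveredQuadruple.symm,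
        hX.isControllablePair_ϑ₁ h.controllable, hX.isControllablePair_ϑ₂ h.observable⟩⟩
  refine ⟨⟨?_, fun hφ => ?_⟩, fun hφ n hn => ⟨?_, main n⟩⟩
  · rintro ⟨n, Q, -, rfl⟩
    exact Q.strictlyProper_φ₁
  · obtain ⟨γ, θ₁, θ₂, h⟩ := hφ.exists_minimalRealization
    obtain ⟨⟨X, hX, -⟩, hall⟩ := main _ γ θ₁ θ₂ h
    exact ⟨_, recoveredQuadruple γ θ₁ θ₂ X, (hall X hX).1, (hall X hX).2.1⟩
  · subst hn
    exact hφ.exists_minimalRealization
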